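/- Let $G=(V,E)$ be a finite connected simple graph that is even-hole-free (no induced cycle of even length $\ge 4$) and claw-free (no induced $K_{1,3}$). Let $K_s\subseteq V$ be a simplicial clique of $G$, that is, a nonempty clique such that the extended graph $G_\chi$, obtained from $G$ by adding one new vertex $\chi$ adjacent exactly to the vertices of $K_s$, is again claw-free. Let $b_j\in\mathbb R\setminus\{0\}$ ($j\in V$). In the complex graph Clifford algebra of $G_\chi$ (generators $h_j$, $j\in V$, and the edge operator $\chi$; each squares to $1$; two of them anticommute if the corresponding vertices are adjacent in $G_\chi$ and commute otherwise), or in any representation of it in a unital associative complex algebra, put $\mathtt H_j=b_jh_j$ and $H_G=\sum_{j\in V}\mathtt H_j$. For $S\subseteq V$ let $P_{G[S]}(x)=\sum_{T}(-x)^{|T|}\prod_{j\in T}b_j^2$, where $T$ runs over the independent sets of $G$ contained in $S$; write $P_G=P_{G[V]}$ and $P_{G\setminus K_s}=P_{G[V\setminus K_s]}$. For an induced path $\mathcal L=\chi\text{-}\ell_1\text{-}\cdots\text{-}\ell_n$ in $G_\chi$ starting at $\chi$, put $|\mathcal L|=n+1$ and $\mathtt H[\mathcal L]=\chi\,\mathtt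 H_{\ell_1}\cdots\mathtt H_{\ell_n}$, and let $P_{\overline{\mathcal L}}$ be the polynomial of the subgraph of $G$ induced on the vertices that neither lie on $\mathcal L$ nor are adjacent in $G_\chi$ to a vertex of $\mathcal L$. For real $u$ put $$\mathcal N(u)=2\sqrt{-u^2P_{G\setminus K_s}(u^2)P_G'(u^2)},\qquad \Psi(u)=\frac1{\mathcal N(u)}\sum_{\mathcal L}(-u)^{|\mathcal L|-1}P_{\overline{\mathcal L}}(u^2)\,\mathtt H[\mathcal L],$$ the sum being over all induced paths $\mathcal L$ in $G_\chi$ starting at $\chi$ (including $\mathcal L=(\chi)$). Then: 1. Counted with multiplicity, $P_G$ has exactly $\alpha_G$ positive roots $x=u_k^2$, where $\alpha_G$ is the independence number of $G$. Let $u_k>0$, $k=1,\dots,\alpha_G$, be the corresponding positive roots of $P_G(u^2)=0$, and put $u_{-k}=-u_k$ and $\Psi_k=\Psi(u_k)$ for $k=\pm1,\dots,\pm\alpha_G$. 2. For every $k=\pm1,\dots,\pm\alpha_G$ whose root is simple and has nonzero residue, i.e. $P_G'(u_k^2)\ne0$ and $P_{G\setminus K_s}(u_k^2)\neq0$, the radicand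 in $\mathcal N(u_k)$ is positive, and $\Psi_k$ is a mode of $H_G$ with single-particle energy $\epsilon_k=1/u_k$: $$[H_G,\Psi_k]=2\epsilon_k\Psi_k .$$ 3. For all $k,l\in\{\pm1,\dots,\pm\alpha_G\}$ whose roots both satisfy these two conditions, $$\{\Psi_k,\Psi_l\}=\delta_{k+l,0}.$$ -/

import Mathlib

open Polynomial

noncomputable section

namespace HiddenFreeFermion

/-! ### Graphs: claws, even holes, simplicial cliques -/

/-- No induced subgraph is a claw `K_{1,3}`. -/
def ClawFree {W : Type*} (G : SimpleGraph W) : Prop :=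
  ¬ (completeBipartiteGraph (Fin 1) (Fin 3)).IsIndContained G

/-- No induced subgraph is a cycle of even length at least four. -/
def EvenHoleFree {W : Type*} (G : SimpleGraph W) : Prop :=
  ∀ n : ℕ, 4 ≤ n → Even n → ¬ (SimpleGraph.cycleGraph n).IsIndContained G

/-- Even-hole-free and claw-free. -/
def IsECF {W : Type*} (G : SimpleGraph W) : Prop :=
  EvenHoleFree G ∧ ClawFree G

/-- The extended graph: one new vertex `none` (written `χ` in the mathematics) is added to `G`
and joined exactly to the vertices of `K`. -/
def extendedGraph {V : Type*} (G : SimpleGraph V) (K : Finset V) : SimpleGraph (Option V) where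
  Adj
    | some i, some j => G.Adj i j
    | none, some j => j ∈ K
    | some i, none => i ∈ K
    | none, none => False
  symm := ⟨by
    rintro (_ | i) (_ | j) h
    · exact h
    · exact h
    · exact h
    · exact SimpleGraph.Adj.symm h⟩
  loopless := ⟨by
    rintro (_ | i) h
    · exact h
    · exact G.irrefl h⟩

/-- A simplicial clique of a (claw-free) graph: a nonempty clique such that the extended graph
is still claw-free. -/
def IsSimplicialClique {V : Type*} (G : SimpleGraph V) (K : Finset V) : Prop :=
  K.Nonempty ∧ G.IsClique (K : Set V) ∧ ClawFree (extendedGraph G K)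

/-! ### Induced paths -/

/-- A nonempty list of distinct vertices in which two entries are adjacent if and only if their
positions differ by one. -/
def IsInducedPath {W : Type*} (G : SimpleGraph W) (l : List W) : Prop :=
  l ≠ [] ∧ l.Nodup ∧
    ∀ (i j : ℕ) (hi : i < l.length) (hj : j < l.length),
      G.Adj l[i] l[j] ↔ (i + 1 = j ∨ j + 1 = i)

open Classical in
/-- The finite set of all induced paths of `G` whose first vertex is `v`. -/
def inducedPathsFrom {W : Type*} [Fintype W] (G : SimpleGraph W) (v : W) : Finset (List W) :=
  ((Finset.univ : Finset {l : List W // l.Nodup}).map (Function.Embedding.subtype _)).filter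
    fun l => IsInducedPath G l ∧ l.head? = some v

theorem mem_inducedPathsFrom {W : Type*} [Fintype W] (G : SimpleGraph W) (v : W) (l : List W) :
    l ∈ inducedPathsFrom G v ↔ IsInducedPath G l ∧ l.head? = some v := by
  classical
  simp only [inducedPathsFrom, Finset.mem_filter, Finset.mem_map, Finset.mem_univ, true_and,
    Function.Embedding.subtype_apply, Subtype.exists, exists_prop, exists_eq_right]
  exact ⟨fun h => h.2, fun h => ⟨h.1.2.1, h⟩⟩

open Classical in
/-- The vertices of `G` that remain after the closed neighbourhood, taken in the extended graph,
of the path `l` has been removed. -/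
def residual {V : Type*} [Fintype V] (G : SimpleGraph V) (K : Finset V) (l : List (Option V)) :
    Finset V :=
  Finset.univ.filter fun i => ∀ w ∈ l, some i ≠ w ∧ ¬ (extendedGraph G K).Adj w (some i)

/-! ### Independence polynomial -/

open Classical in
/-- The weighted independence polynomial `∑_T (-x)^|T| ∏_{j ∈ T} b_j²` of the subgraph of `G`
induced on `S`; the sum is over the independent sets `T ⊆ S`. -/
def indepPoly {V : Type*} (G : SimpleGraph V) (b : V → ℝ) (S : Finset V) : ℝ[X] :=
  ∑ T ∈ S.powerset.filter (fun T : Finset V => G.IsIndepSet (T : Set V)),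
    (-X) ^ T.card * ∏ j ∈ T, C (b j ^ 2)

/-- The independence polynomial of the whole graph. -/
def fullPoly {V : Type*} [Fintype V] (G : SimpleGraph V) (b : V → ℝ) : ℝ[X] :=
  indepPoly G b Finset.univ

open Classical in
/-- The independence polynomial of `G` with the vertices of `K` removed. -/
def deletedPoly {V : Type*} [Fintype V] (G : SimpleGraph V) (K : Finset V) (b : V → ℝ) : ℝ[X] :=
  indepPoly G b (Finset.univ \ K)

/-! ### Graph Clifford algebras -/

/-- Defining relations: the generators square to one; two of them anticommute if the vertices are
adjacent and commute otherwise. -/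
inductive CliffordRel {W : Type*} (G : SimpleGraph W) :
    FreeAlgebra ℂ W → FreeAlgebra ℂ W → Prop
  | sq (v : W) : CliffordRel G (FreeAlgebra.ι ℂ v * FreeAlgebra.ι ℂ v) 1
  | anti (v w : W) (h : G.Adj v w) :
      CliffordRel G (FreeAlgebra.ι ℂ v * FreeAlgebra.ι ℂ w)
        (-(FreeAlgebra.ι ℂ w * FreeAlgebra.ι ℂ v))
  | comm (v w : W) (h : ¬ G.Adj v w) :
      CliffordRel G (FreeAlgebra.ι ℂ v * FreeAlgebra.ι ℂ w)
        (FreeAlgebra.ι ℂ w * FreeAlgebra.ι ℂ v)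

/-- The complex graph Clifford algebra of `G`, presented by generators and relations. -/
abbrev GraphClifford {W : Type*} (G : SimpleGraph W) : Type _ :=
  RingQuot (CliffordRel G)

/-- The generator attached to a vertex. -/
def gen {W : Type*} (G : SimpleGraph W) (v : W) : GraphClifford G :=
  RingQuot.mkAlgHom ℂ (CliffordRel G) (FreeAlgebra.ι ℂ v)

/-! ### Hamiltonian and modes

`φ` is a representation of the graph Clifford algebra of the extended graph in an algebra `A`
(`A` may be that algebra itself, with `φ` the identity). -/

section Modes

variable {V : Type*} [Fintype V] (G : SimpleGraph V) (K : Finset V) (b : V → ℝ)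
  {A : Type*} [Ring A] [Algebra ℂ A] (φ : GraphClifford (extendedGraph G K) →ₐ[ℂ] A)

/-- The operator at a vertex of the extended graph: the edge operator `χ` at the new vertex, and
`b_j h_j` at a vertex `j` of `G`. -/
def vertexOp : Option V → A
  | none => φ (gen (extendedGraph G K) none)
  | some j => (b j : ℂ) • φ (gen (extendedGraph G K) (some j))

/-- `H_G = ∑_j b_j h_j`. -/
def hamiltonian : A := ∑ j : V, vertexOp G K b φ (some j)

/-- The ordered product of the operators along a path. -/
def pathProduct (l : List (Option V)) : A := (l.map (vertexOp G K b φ)).prod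

/-- `-u² P_{G∖K}(u²) P_G'(u²)`, the quantity under the square root in the normalization. -/
def radicand (u : ℝ) : ℝ :=
  -u ^ 2 * (deletedPoly G K b).eval (u ^ 2) * (derivative (fullPoly G b)).eval (u ^ 2)

/-- The normalization factor `2 √(-u² P_{G∖K}(u²) P_G'(u²))`. -/
def normFactor (u : ℝ) : ℝ := 2 * Real.sqrt (radicand G K b u)

/-- The path-product operator `Ψ` attached to the root `u`. -/
def mode (u : ℝ) : A :=
  (1 / normFactor G K b u : ℂ) •
    ∑ l ∈ inducedPathsFrom (extendedGraph G K) none,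
      (((-u) ^ (l.length - 1) * (indepPoly G b (residual G K l)).eval (u ^ 2) : ℝ) : ℂ) •
        pathProduct G K b φ l

/-- `u` is one of the numbers `±u_k`: a nonzero real root of `P_G(u²) = 0` that is simple
(`P_G'(u²) ≠ 0`) and has nonzero residue (`P_{G∖K}(u²) ≠ 0`). -/
def IsGenericRoot (u : ℝ) : Prop :=
  u ≠ 0 ∧ (fullPoly G b).eval (u ^ 2) = 0 ∧ (derivative (fullPoly G b)).eval (u ^ 2) ≠ 0 ∧
    (deletedPoly G K b).eval (u ^ 2) ≠ 0

end Modes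

end HiddenFreeFermion

end

/-! Let `S` be a set of vertices and `v` a vertex outside it whose neighbours in `S` form a clique
`K`; let `S'` be `S` without `K`. Write `P_S` for the independence polynomial at `u²`, with weights
`β_j` the squares of the operators, and `Φ_v(S)` for the weighted sum of path products over induced
paths from `v` through `S`. Both obey a recursion over the same clique: `P_S = P_{S'} - u² ∑ β_j
P_{S' ∖ N(j)}` and `Φ_v(S) = op v * (P_{S'} - u ∑ Φ_j(S'))`, with `j` running over `K`.
Claw-freeness makes the neighbours of each such `j` in `S'` a clique again, so the recursions can be
iterated.

Induction on `S` then gives `u [H_S, Φ_v(S)] = 2 (Φ_v(S) - P_S op v)` (`commutator_pathSum`). The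
step needs the anticommutator of `∑ op i` and `∑ Φ_j(S')` over `K` to be a scalar
(`sum_anticomm_pathSum`). Its mixed terms cancel in pairs: by claw-freeness only those continuations
`T` of `j` survive which `i` meets in a single end vertex, and `T` or its reversal is then a
continuation of `i`. If a reversal is needed, `i`, `j` and `T` form a hole; its length is odd, so
reversing the product costs no sign. With `v = χ`, the identity at a root of `P_G(u²)` says that the
path sum is a mode.

For the anticommutators, `u` becomes an indeterminate. The commutator identity says that the
coefficients of the path sum arise from `χ` by iterating `[H, ·]/2`, up to multiples of `χ`, and
their anticommutators with `χ` are scalar. Since a scalar commutes with `H`, the commutator can be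
shifted from one factor to the other, so all anticommutators are scalar
(`exists_anticomm_eq_algebraMap`). Commuting once more with `H` gives a closed formula for `(u + v)
{Φ(u), Φ(v)}` (`add_smul_evalAt_anticomm`). It vanishes at two roots, and differentiating it at `v =
-u` yields the normalization.

The same recursion turns `P_{G∖K}/P_G` into a continued fraction mapping the upper half-plane into
its closure (`IsRooted.halfPlane`). Hence `P_G` is real-rooted, and the sign of a residue makes the
radicand positive. Connectedness ensures that the recursion reaches every vertex. -/

noncomputable section

namespace HiddenFreeFermion

open Classical

/-! ### Weighted independence polynomials -/

section Graph

variable {W : Type*} (Γ : SimpleGraph W)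

/-- The neighbours of `v` in `S`. -/
def nbrs (v : W) (S : Finset W) : Finset W := S.filter fun x => Γ.Adj v x

/-- The vertices of `S` that are not neighbours of `v`. -/
def rest (v : W) (S : Finset W) : Finset W := S.filter fun x => ¬ Γ.Adj v x

/-- The multivariate independence polynomial of the graph induced on `S`. -/
def wIndep {R : Type*} [CommRing R] (w : W → R) (S : Finset W) : R :=
  ∑ T ∈ S.powerset.filter (fun T : Finset W => Γ.IsIndepSet (T : Set W)), ∏ j ∈ T, w j

variable {Γ}

theorem mem_nbrs {v x : W} {S : Finset W} : x ∈ nbrs Γ v S ↔ x ∈ S ∧ Γ.Adj v x := by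
  simp [nbrs]

theorem mem_rest {v x : W} {S : Finset W} : x ∈ rest Γ v S ↔ x ∈ S ∧ ¬ Γ.Adj v x := by
  simp [rest]

theorem disjoint_rest_nbrs (v : W) (S : Finset W) : Disjoint (rest Γ v S) (nbrs Γ v S) :=
  (Finset.disjoint_filter_filter_not S S _).symm

theorem rest_union_nbrs (v : W) (S : Finset W) : rest Γ v S ∪ nbrs Γ v S = S := by
  rw [Finset.union_comm]; exact Finset.filter_union_filter_not_eq _ S

theorem rest_subset (v : W) (S : Finset W) : rest Γ v S ⊆ S := Finset.filter_subset _ _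

variable {R : Type*} [CommRing R] (w : W → R)

theorem wIndep_empty : wIndep Γ w ∅ = 1 := by
  simp [wIndep, Finset.filter_singleton, SimpleGraph.IsIndepSet]

theorem wIndep_insert {v : W} {S : Finset W} (hv : v ∉ S) :
    wIndep Γ w (insert v S) = wIndep Γ w S + w v * wIndep Γ w (rest Γ v S) := by
  have hdisj : Disjoint S.powerset (S.powerset.image (insert v)) := by
    rw [Finset.disjoint_left]
    intro T hT hT'
    obtain ⟨T', -, rfl⟩ := Finset.mem_image.1 hT'
    exact hv (Finset.mem_powerset.1 hT (Finset.mem_insert_self _ _))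
  have hsum : wIndep Γ w (insert v S) = wIndep Γ w S +
      ∑ T ∈ (S.powerset.image (insert v)).filter
        (fun T : Finset W => Γ.IsIndepSet (T : Set W)), ∏ j ∈ T, w j := by
    unfold wIndep
    rw [Finset.powerset_insert, Finset.filter_union, Finset.sum_union]
    exact hdisj.mono (Finset.filter_subset _ _) (Finset.filter_subset _ _)
  rw [hsum, wIndep, wIndep, Finset.mul_sum]
  congr 1
  symm
  refine Finset.sum_bij (fun T _ => insert v T) ?_ ?_ ?_ ?_
  · intro T hT
    simp only [Finset.mem_filter, Finset.mem_powerset, Finset.mem_image] at hT ⊢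
    refine ⟨⟨T, hT.1.trans (rest_subset v S), rfl⟩, ?_⟩
    rw [SimpleGraph.IsIndepSet, Finset.coe_insert, Set.pairwise_insert]
    exact ⟨hT.2, fun x hx _ => ⟨(mem_rest.1 (hT.1 hx)).2,
      fun h => (mem_rest.1 (hT.1 hx)).2 h.symm⟩⟩
  · intro T hT T' hT' h
    simp only [Finset.mem_filter, Finset.mem_powerset] at hT hT'
    have h1 : v ∉ T := fun h => hv (rest_subset v S (hT.1 h))
    have h2 : v ∉ T' := fun h => hv (rest_subset v S (hT'.1 h))
    rw [← Finset.erase_insert h1, ← Finset.erase_insert h2, h]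
  · intro T hT
    simp only [Finset.mem_filter, Finset.mem_powerset, Finset.mem_image] at hT ⊢
    obtain ⟨⟨T', hT', rfl⟩, hind⟩ := hT
    have hv' : v ∉ T' := fun h => hv (hT' h)
    rw [SimpleGraph.IsIndepSet, Finset.coe_insert, Set.pairwise_insert] at hind
    refine ⟨T', ⟨fun x hx => mem_rest.2 ⟨hT' hx, ?_⟩, hind.1⟩, rfl⟩
    exact (hind.2 x hx (by rintro rfl; exact hv' hx)).1
  · intro T hT
    simp only [Finset.mem_filter, Finset.mem_powerset] at hT
    rw [Finset.prod_insert (fun h => hv (rest_subset v S (hT.1 h)))]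

/-- An independent set contains at most one vertex of a clique, and the terms are sorted by that
vertex. Deleting the neighbours of one clique vertex deletes the rest of the clique too. -/
theorem wIndep_union_clique {S K : Finset W} (hK : Γ.IsClique (K : Set W)) (hd : Disjoint S K) :
    wIndep Γ w (S ∪ K) = wIndep Γ w S + ∑ j ∈ K, w j * wIndep Γ w (rest Γ j S) := by
  induction K using Finset.induction_on with
  | empty => simp
  | insert k K hk ih =>
    rw [Finset.coe_insert, SimpleGraph.isClique_insert] at hK
    rw [Finset.disjoint_insert_right] at hd
    have hrest : rest Γ k (S ∪ K) = rest Γ k S := by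
      ext x
      simp only [mem_rest, Finset.mem_union]
      refine ⟨fun h => ⟨h.1.resolve_right fun hx => h.2 (hK.2 x hx ?_), h.2⟩,
        fun h => ⟨Or.inl h.1, h.2⟩⟩
      rintro rfl; exact hk hx
    rw [Finset.union_insert, wIndep_insert w (by simp [hd.1, hk]), ih hK.1 hd.2, hrest,
      Finset.sum_insert hk]
    ring

theorem wIndep_eq_rest {S : Finset W} {v : W} (hK : Γ.IsClique (nbrs Γ v S : Set W)) :
    wIndep Γ w S = wIndep Γ w (rest Γ v S) +
      ∑ j ∈ nbrs Γ v S, w j * wIndep Γ w (rest Γ j (rest Γ v S)) := by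
  conv_lhs => rw [← rest_union_nbrs (Γ := Γ) v S]
  exact wIndep_union_clique w hK (disjoint_rest_nbrs v S)

/-! ### Claws and holes -/

theorem ClawFree.false_of_adj (hΓ : ClawFree Γ) {c x y z : W} (hx : Γ.Adj c x) (hy : Γ.Adj c y)
    (hz : Γ.Adj c z) (hxy : x ≠ y) (hxz : x ≠ z) (hyz : y ≠ z) (nxy : ¬ Γ.Adj x y)
    (nxz : ¬ Γ.Adj x z) (nyz : ¬ Γ.Adj y z) : False := by
  apply hΓ
  have e1 := hx.symm
  have e2 := hy.symm
  have e3 := hz.symm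
  have n1 := fun h : Γ.Adj y x => nxy h.symm
  have n2 := fun h : Γ.Adj z x => nxz h.symm
  have n3 := fun h : Γ.Adj z y => nyz h.symm
  have hinj : Function.Injective (Sum.elim (fun _ => c) ![x, y, z] : Fin 1 ⊕ Fin 3 → W) := by
    rintro (a | a) (b | b) h
    · simp [Subsingleton.elim a b]
    · fin_cases b <;> simp at h <;> subst h <;> simp_all
    · fin_cases a <;> simp at h <;> subst h <;> simp_all
    · fin_cases a <;> fin_cases b <;> simp_all
  refine ⟨⟨⟨_, hinj⟩, fun {a b} => ?_⟩⟩
  show Γ.Adj (Sum.elim (fun _ => c) ![x, y, z] a) (Sum.elim (fun _ => c) ![x, y, z] b) ↔ _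
  rcases a with a | a <;> rcases b with b | b
  · simp
  · fin_cases b <;> simp [hx, hy, hz]
  · fin_cases a <;> simp [e1, e2, e3]
  · fin_cases a <;> fin_cases b <;> simp_all

/-- Two non-adjacent members would form, together with `v`, a claw centred at `j`. This passes the
clique condition on to the next vertex of a path. -/
theorem ClawFree.isClique_nbrs_rest (hΓ : ClawFree Γ) {v j : W} {S : Finset W} (hv : v ∉ S)
    (hj : j ∈ nbrs Γ v S) : Γ.IsClique (nbrs Γ j (rest Γ v S) : Set W) := by
  intro x hx y hy hxy
  simp only [Finset.mem_coe, mem_nbrs, mem_rest] at hx hy hj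
  by_contra h
  exact hΓ.false_of_adj hj.2.symm hx.2 hy.2 (by rintro rfl; exact hv hx.1.1)
    (by rintro rfl; exact hv hy.1.1) hxy hx.1.2 hy.1.2 h

theorem isInducedPath_singleton (x : W) : IsInducedPath Γ [x] := by
  refine ⟨by simp, by simp, fun i j hi hj => ?_⟩
  simp only [List.length_singleton, Nat.lt_one_iff] at hi hj
  subst hi hj
  simp

theorem isInducedPath_cons_cons {x y : W} {T : List W} :
    IsInducedPath Γ (x :: y :: T) ↔
      x ∉ y :: T ∧ Γ.Adj x y ∧ (∀ z ∈ T, ¬ Γ.Adj x z) ∧ IsInducedPath Γ (y :: T) := by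
  constructor
  · rintro ⟨-, hnd, h⟩
    rw [List.nodup_cons] at hnd
    refine ⟨hnd.1, (h 0 1 (by simp) (by simp)).2 (by simp), ?_, by simp, hnd.2, ?_⟩
    · intro z hz hadj
      obtain ⟨k, hk, rfl⟩ := List.mem_iff_getElem.1 hz
      have := (h 0 (k + 2) (by simp) (by simp; omega)).1 (by simpa using hadj)
      omega
    · intro i j hi hj
      have := h (i + 1) (j + 1) (by simpa using hi) (by simpa using hj)
      simp only [List.getElem_cons_succ] at this
      rw [this]; omega
  · rintro ⟨hx, hxy, hxz, -, hnd, h⟩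
    refine ⟨by simp, List.nodup_cons.2 ⟨hx, hnd⟩, ?_⟩
    have h0 : ∀ (j : ℕ) (hj : j < (y :: T).length), Γ.Adj x (y :: T)[j] ↔ j = 0 := by
      intro j hj
      rcases j with _ | j
      · simpa using hxy
      · simpa using hxz _ (List.getElem_mem _)
    rintro (_ | i) (_ | j) hi hj
    · simp
    · simp only [List.getElem_cons_zero, List.getElem_cons_succ]
      rw [h0]; omega
    · simp only [List.getElem_cons_zero, List.getElem_cons_succ]
      rw [SimpleGraph.adj_comm, h0]; omega
    · simp only [List.getElem_cons_succ]
      rw [h]; omega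

theorem IsInducedPath.reverse {L : List W} (h : IsInducedPath Γ L) :
    IsInducedPath Γ L.reverse := by
  refine ⟨by simpa using h.1, List.nodup_reverse.2 h.2.1, fun i j hi hj => ?_⟩
  rw [List.length_reverse] at hi hj
  rw [List.getElem_reverse, List.getElem_reverse, h.2.2]
  omega

/-- An induced path closed up by a vertex adjacent exactly to its two ends is a hole. -/
theorem cycleGraph_isIndContained {L : List W} (h : IsInducedPath Γ L) {c : W} (hc : c ∉ L)
    (hlen : 3 ≤ L.length)
    (hadj : ∀ (k : ℕ) (hk : k < L.length), Γ.Adj c L[k] ↔ (k = 0 ∨ k + 1 = L.length)) :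
    (SimpleGraph.cycleGraph (L.length + 1)).IsIndContained Γ := by
  have hnd : (c :: L).Nodup := List.nodup_cons.2 ⟨hc, h.2.1⟩
  have key : ∀ (i j : ℕ) (hi : i < (c :: L).length) (hj : j < (c :: L).length), i < j →
      (Γ.Adj (c :: L)[i] (c :: L)[j] ↔ (i + 1 = j ∨ (i = 0 ∧ j = L.length))) := by
    rintro (_ | i) (_ | j) hi hj hij
    · omega
    · simp only [List.getElem_cons_zero, List.getElem_cons_succ]
      rw [hadj, true_and]; omega
    · omega
    · simp only [List.getElem_cons_succ]
      rw [h.2.2]; omega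
  have hcyc : ∀ i j : Fin (L.length + 1), (i : ℕ) < j →
      ((SimpleGraph.cycleGraph (L.length + 1)).Adj i j ↔
        ((i : ℕ) + 1 = j ∨ ((i : ℕ) = 0 ∧ (j : ℕ) = L.length))) := by
    intro i j hij
    rw [SimpleGraph.cycleGraph_adj']
    have h1 : ((j - i : Fin (L.length + 1)) : ℕ) = j - i := Fin.sub_val_of_le hij.le
    have h2 : ((i - j : Fin (L.length + 1)) : ℕ) = L.length + 1 + i - j := Fin.coe_sub_iff_lt.2 hij
    have := i.2
    have := j.2
    rw [h1, h2]
    omega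
  have hinj : Function.Injective fun i : Fin (L.length + 1) => (c :: L)[(i : ℕ)]'i.2 :=
    fun i j hij => Fin.ext ((List.Nodup.getElem_inj_iff hnd).1 hij)
  refine ⟨⟨⟨_, hinj⟩, fun {i j} => ?_⟩⟩
  show Γ.Adj ((c :: L)[(i : ℕ)]'i.2) ((c :: L)[(j : ℕ)]'j.2) ↔ _
  rcases lt_trichotomy (i : ℕ) j with hij | hij | hij
  · rw [key _ _ _ _ hij, hcyc _ _ hij]
  · have : i = j := Fin.ext hij
    subst this; simp
  · rw [SimpleGraph.adj_comm, key _ _ _ _ hij, SimpleGraph.adj_comm, hcyc _ _ hij]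

end Graph

/-! ### Continuations of induced paths and their reversal -/

section Tails

variable {W : Type*} {Γ : SimpleGraph W}

/-- Among the entries of `L`, exactly the one at position `k` is adjacent to `i`. -/
def MeetsOnlyAt (Γ : SimpleGraph W) (i : W) (L : List W) (k : ℕ) : Prop :=
  k < L.length ∧ ∀ (m : ℕ) (hm : m < L.length), Γ.Adj i L[m] ↔ m = k

theorem MeetsOnlyAt.reverse {i : W} {L : List W} {k : ℕ} (h : MeetsOnlyAt Γ i L k) :
    MeetsOnlyAt Γ i L.reverse (L.length - 1 - k) := by
  have hk := h.1
  refine ⟨by rw [List.length_reverse]; omega, fun m hm => ?_⟩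
  rw [List.length_reverse] at hm
  rw [List.getElem_reverse, h.2]
  omega

theorem MeetsOnlyAt.unique {i : W} {L : List W} {k l : ℕ} (h : MeetsOnlyAt Γ i L k)
    (h' : MeetsOnlyAt Γ i L l) : k = l :=
  (h'.2 k h.1).1 ((h.2 k h.1).2 rfl)

theorem isInducedPath_cons {x : W} {T : List W} (hT : T ≠ []) :
    IsInducedPath Γ (x :: T) ↔ x ∉ T ∧ MeetsOnlyAt Γ x T 0 ∧ IsInducedPath Γ T := by
  obtain ⟨y, T, rfl⟩ := List.exists_cons_of_ne_nil hT
  rw [isInducedPath_cons_cons]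
  refine and_congr_right fun _ => ?_
  rw [← and_assoc]
  refine and_congr_left fun _ => ?_
  constructor
  · rintro ⟨h1, h2⟩
    refine ⟨by simp, ?_⟩
    rintro (_ | m) hm
    · simpa using h1
    · simpa using h2 _ (List.getElem_mem _)
  · rintro ⟨-, h⟩
    refine ⟨(h 0 (by simp)).2 rfl, fun z hz hadj => ?_⟩
    obtain ⟨k, hk, rfl⟩ := List.mem_iff_getElem.1 hz
    have := (h (k + 1) (by simpa using hk)).1 hadj
    omega

theorem countP_eq_card {L : List W} (hL : L.Nodup) (i : W) :
    L.countP (fun x => decide (Γ.Adj i x)) = (L.toFinset.filter fun x => Γ.Adj i x).card := by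
  rw [List.countP_eq_length_filter, ← List.toFinset_card_of_nodup (hL.filter _),
    List.toFinset_filter]
  simp

theorem MeetsOnlyAt.countP_eq_one {i : W} {L : List W} {k : ℕ} (h : MeetsOnlyAt Γ i L k)
    (hL : L.Nodup) : L.countP (fun x => decide (Γ.Adj i x)) = 1 := by
  rw [countP_eq_card hL, Finset.card_eq_one]
  refine ⟨L[k]'h.1, ?_⟩
  ext x
  simp only [Finset.mem_filter, List.mem_toFinset, Finset.mem_singleton]
  constructor
  · rintro ⟨hx, hadj⟩
    obtain ⟨m, hm, rfl⟩ := List.mem_iff_getElem.1 hx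
    have := (h.2 m hm).1 hadj
    subst this; rfl
  · rintro rfl
    exact ⟨List.getElem_mem _, (h.2 k h.1).2 rfl⟩

/-- In a claw-free graph, a vertex whose neighbours on an induced path form a clique of odd
cardinality has exactly one neighbour on the path, at one of the two ends. -/
theorem exists_meetsOnlyAt_of_odd (hΓ : ClawFree Γ) {L : List W} (hL : IsInducedPath Γ L) {i : W}
    (hi : i ∉ L) (hcl : ∀ x ∈ L, ∀ y ∈ L, Γ.Adj i x → Γ.Adj i y → x ≠ y → Γ.Adj x y)
    (hodd : Odd (L.countP fun x => decide (Γ.Adj i x))) :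
    ∃ k, (k = 0 ∨ k + 1 = L.length) ∧ MeetsOnlyAt Γ i L k := by
  rw [countP_eq_card hL.2.1] at hodd
  have hle : (L.toFinset.filter fun x => Γ.Adj i x).card ≤ 2 := by
    by_contra! hlt
    obtain ⟨x, y, z, hx, hy, hz, hxy, hxz, hyz⟩ := Finset.two_lt_card_iff.1 hlt
    simp only [Finset.mem_filter, List.mem_toFinset] at hx hy hz
    -- Three positions on an induced path cannot pairwise differ by one.
    have a1 := hcl _ hx.1 _ hy.1 hx.2 hy.2 hxy
    have a2 := hcl _ hx.1 _ hz.1 hx.2 hz.2 hxz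
    have a3 := hcl _ hy.1 _ hz.1 hy.2 hz.2 hyz
    obtain ⟨a, ha, rfl⟩ := List.mem_iff_getElem.1 hx.1
    obtain ⟨b, hb, rfl⟩ := List.mem_iff_getElem.1 hy.1
    obtain ⟨c, hc, rfl⟩ := List.mem_iff_getElem.1 hz.1
    rw [hL.2.2] at a1 a2 a3
    omega
  have hone : (L.toFinset.filter fun x => Γ.Adj i x).card = 1 := by
    obtain ⟨t, ht⟩ := hodd; omega
  obtain ⟨x, hx⟩ := Finset.card_eq_one.1 hone
  have hxm : x ∈ L.toFinset.filter fun x => Γ.Adj i x := by rw [hx]; simp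
  simp only [Finset.mem_filter, List.mem_toFinset] at hxm
  obtain ⟨k, hk, rfl⟩ := List.mem_iff_getElem.1 hxm.1
  have hmeet : MeetsOnlyAt Γ i L k := by
    refine ⟨hk, fun m hm => ⟨fun h => ?_, fun h => by subst h; exact hxm.2⟩⟩
    have : L[m] ∈ L.toFinset.filter fun x => Γ.Adj i x := by
      simp only [Finset.mem_filter, List.mem_toFinset]
      exact ⟨List.getElem_mem _, h⟩
    rw [hx, Finset.mem_singleton] at this
    exact (List.Nodup.getElem_inj_iff hL.2.1).1 this
  refine ⟨k, ?_, hmeet⟩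
  -- At an interior position, `L[k]` would be the centre of a claw with leaves its two path
  -- neighbours and `i`.
  by_contra! hint
  have h1 : k - 1 < L.length := by omega
  have h2 : k + 1 < L.length := by omega
  refine hΓ.false_of_adj (c := L[k]) (x := L[k - 1]) (y := L[k + 1]) (z := i)
    ((hL.2.2 _ _ _ _).2 (by omega)) ((hL.2.2 _ _ _ _).2 (by omega)) hxm.2.symm ?_ ?_ ?_ ?_ ?_ ?_
  · rw [Ne, List.Nodup.getElem_inj_iff hL.2.1]; omega
  · rintro rfl; exact hi (List.getElem_mem _)
  · rintro rfl; exact hi (List.getElem_mem _)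
  · rw [hL.2.2]; omega
  · rw [SimpleGraph.adj_comm, hmeet.2]; omega
  · rw [SimpleGraph.adj_comm, hmeet.2]; omega

/-- The vertices of `S` neither on `L` nor adjacent to a vertex of `L`. -/
def far (Γ : SimpleGraph W) (L : List W) (S : Finset W) : Finset W :=
  S.filter fun x => ∀ y ∈ L, x ≠ y ∧ ¬ Γ.Adj y x

theorem far_singleton {v : W} {S : Finset W} (hv : v ∉ S) : far Γ [v] S = rest Γ v S := by
  ext x
  simp only [far, Finset.mem_filter, List.mem_singleton, forall_eq, mem_rest]
  exact and_congr_right fun hx => ⟨fun h => h.2, fun h => ⟨by rintro rfl; exact hv hx, h⟩⟩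

theorem far_cons {v : W} {S : Finset W} (hv : v ∉ S) (L : List W) :
    far Γ (v :: L) S = far Γ L (rest Γ v S) := by
  ext x
  simp only [far, Finset.mem_filter, List.mem_cons, forall_eq_or_imp, mem_rest]
  constructor
  · rintro ⟨h1, ⟨-, h2⟩, h3⟩; exact ⟨⟨h1, h2⟩, h3⟩
  · rintro ⟨⟨h1, h2⟩, h3⟩
    exact ⟨h1, ⟨by rintro rfl; exact hv h1, h2⟩, h3⟩

theorem far_reverse (L : List W) (S : Finset W) : far Γ L.reverse S = far Γ L S := by
  simp [far]

/-- The neighbours of `j` in `S` form a clique containing `y`, so `y` on the path already excludes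
them all. The coefficient of a path thus does not see which vertex it was started from. -/
theorem far_cons_of_isClique {j y : W} {S : Finset W} {T : List W} (hj : j ∉ S)
    (hcl : Γ.IsClique (nbrs Γ j S : Set W)) (hyT : y ∈ T) (hy : y ∈ nbrs Γ j S) :
    far Γ (j :: T) S = far Γ T S := by
  ext x
  simp only [far, Finset.mem_filter, List.mem_cons, forall_eq_or_imp]
  refine and_congr_right fun hx => ⟨fun h => h.2, fun h => ⟨⟨?_, fun hadj => ?_⟩, h⟩⟩
  · rintro rfl; exact hj hx
  · have hxn : x ∈ nbrs Γ j S := mem_nbrs.2 ⟨hx, hadj⟩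
    exact (h y hyT).2 (hcl hy hxn (h y hyT).1.symm)

/-- Reverse a continuation that is not met by `i` in its first vertex. -/
def flip (Γ : SimpleGraph W) (i : W) (T : List W) : List W :=
  if MeetsOnlyAt Γ i T 0 then T else T.reverse

theorem far_flip (i : W) (T : List W) (S : Finset W) :
    far Γ (flip Γ i T) S = far Γ T S := by
  unfold flip; split_ifs
  · rfl
  · exact far_reverse T S

theorem length_flip (i : W) (T : List W) : (flip Γ i T).length = T.length := by
  unfold flip; split_ifs <;> simp

variable [Fintype W]

/-- The continuations `T` inside `S` of the vertex `v` to an induced path `v :: T`. -/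
def tails (Γ : SimpleGraph W) (S : Finset W) (v : W) : Finset (List W) :=
  ((Finset.univ : Finset {l : List W // l.Nodup}).map (Function.Embedding.subtype _)).filter
    fun T => IsInducedPath Γ (v :: T) ∧ ∀ x ∈ T, x ∈ S

theorem mem_tails {S : Finset W} {v : W} {T : List W} :
    T ∈ tails Γ S v ↔ IsInducedPath Γ (v :: T) ∧ ∀ x ∈ T, x ∈ S := by
  simp only [tails, Finset.mem_filter, Finset.mem_map, Finset.mem_univ, true_and,
    Function.Embedding.subtype_apply, Subtype.exists, exists_prop, exists_eq_right]
  exact ⟨fun h => h.2, fun h => ⟨(List.nodup_cons.1 h.1.2.1).2, h⟩⟩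

theorem cons_mem_tails {S : Finset W} {v j : W} {T : List W} (hv : v ∉ S) :
    j :: T ∈ tails Γ S v ↔ j ∈ nbrs Γ v S ∧ T ∈ tails Γ (rest Γ v S) j := by
  simp only [mem_tails, isInducedPath_cons_cons, mem_nbrs, mem_rest, List.mem_cons,
    forall_eq_or_imp]
  constructor
  · rintro ⟨⟨h1, h2, h3, h4⟩, h5, h6⟩
    exact ⟨⟨h5, h2⟩, h4, fun x hx => ⟨h6 x hx, h3 x hx⟩⟩
  · rintro ⟨⟨h1, h2⟩, h3, h4⟩
    refine ⟨⟨?_, h2, fun z hz => (h4 z hz).2, h3⟩, h1, fun x hx => (h4 x hx).1⟩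
    rintro (rfl | h)
    · exact hv h1
    · exact hv (h4 _ h).1

/-- A continuation is empty or begins with a neighbour `j` of `v`; inducedness keeps its later
vertices away from the other neighbours of `v`. -/
theorem sum_tails {M : Type*} [AddCommMonoid M] {S : Finset W} {v : W} (hv : v ∉ S)
    (F : List W → M) :
    ∑ T ∈ tails Γ S v, F T =
      F [] + ∑ j ∈ nbrs Γ v S, ∑ T ∈ tails Γ (rest Γ v S) j, F (j :: T) := by
  have hset : tails Γ S v = insert [] ((nbrs Γ v S).biUnion fun j =>
      (tails Γ (rest Γ v S) j).image (List.cons j)) := by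
    ext T
    rcases T with _ | ⟨j, T⟩
    · simp [mem_tails, isInducedPath_singleton]
    · simp [cons_mem_tails hv]
  rw [hset, Finset.sum_insert (by simp), Finset.sum_biUnion]
  · congr 1
    refine Finset.sum_congr rfl fun j _ => Finset.sum_image ?_
    intro a _ b _ h
    exact (List.cons.inj h).2
  · intro i _ j _ hij
    rw [Function.onFun, Finset.disjoint_left]
    intro T hT hT'
    obtain ⟨a, -, rfl⟩ := Finset.mem_image.1 hT
    obtain ⟨b, -, h⟩ := Finset.mem_image.1 hT'
    exact hij (List.cons.inj h).1.symm

/-- The continuations of `j` inside `S` that contain an odd number of neighbours of `i`. -/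
def oddTails (Γ : SimpleGraph W) (S : Finset W) (j i : W) : Finset (List W) :=
  (tails Γ S j).filter fun T => Odd (T.countP fun x => decide (Γ.Adj i x))

/-- Claw-freeness reduces an odd number of contacts to one contact at an end. In this form reversal
can exchange the roles of `i` and `j`. -/
theorem mem_oddTails (hΓ : ClawFree Γ) {S : Finset W} {i j : W} (hi : i ∉ S) (hj : j ∉ S)
    (hcl : Γ.IsClique (nbrs Γ i S : Set W)) {T : List W} :
    T ∈ oddTails Γ S j i ↔ (∀ x ∈ T, x ∈ S) ∧ IsInducedPath Γ T ∧ MeetsOnlyAt Γ j T 0 ∧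
      (MeetsOnlyAt Γ i T 0 ∨ MeetsOnlyAt Γ i T (T.length - 1)) := by
  rw [oddTails, Finset.mem_filter, mem_tails]
  constructor
  · rintro ⟨⟨hp, hS⟩, hodd⟩
    have hne : T ≠ [] := by rintro rfl; simp at hodd
    obtain ⟨hjT, hm, hp⟩ := (isInducedPath_cons hne).1 hp
    obtain ⟨k, hk, hmk⟩ := exists_meetsOnlyAt_of_odd hΓ hp (fun h => hi (hS _ h))
      (fun x hx y hy ax ay hxy => hcl (mem_nbrs.2 ⟨hS x hx, ax⟩) (mem_nbrs.2 ⟨hS y hy, ay⟩) hxy)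
      hodd
    refine ⟨hS, hp, hm, hk.imp (fun h => by rwa [h] at hmk) fun h => ?_⟩
    rwa [show T.length - 1 = k by omega]
  · rintro ⟨hS, hp, hm, hmi⟩
    refine ⟨⟨(isInducedPath_cons hp.1).2 ⟨fun h => hj (hS _ h), hm, hp⟩, hS⟩, ?_⟩
    rcases hmi with h | h <;> rw [h.countP_eq_one hp.2.1] <;> exact odd_one

theorem flip_mem_oddTails (hΓ : ClawFree Γ) {S : Finset W} {i j : W} (hi : i ∉ S) (hj : j ∉ S)
    (hci : Γ.IsClique (nbrs Γ i S : Set W)) (hcj : Γ.IsClique (nbrs Γ j S : Set W)) {T : List W}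
    (hT : T ∈ oddTails Γ S j i) : flip Γ i T ∈ oddTails Γ S i j ∧ flip Γ j (flip Γ i T) = T := by
  rw [mem_oddTails hΓ hi hj hci] at hT
  rw [mem_oddTails hΓ hj hi hcj]
  obtain ⟨hS, hp, hm, hmi⟩ := hT
  by_cases h : MeetsOnlyAt Γ i T 0
  · simp only [flip, if_pos h, if_pos hm]
    exact ⟨⟨hS, hp, h, Or.inl hm⟩, trivial⟩
  · have hmi := hmi.resolve_left h
    have hm' := hm.reverse
    have hmi' := hmi.reverse
    simp only [flip, if_neg h]
    rw [Nat.sub_self] at hmi'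
    rw [Nat.sub_zero] at hm'
    refine ⟨⟨by simpa using hS, hp.reverse, hmi', Or.inr (by simpa using hm')⟩, ?_⟩
    rw [if_neg, List.reverse_reverse]
    -- The two ends coincide only on a one-vertex list, where `i` would meet the first vertex after
    -- all.
    intro h0
    exact h (by rw [hm'.unique h0] at hmi; exact hmi)

theorem far_cons_of_mem_oddTails (hΓ : ClawFree Γ) {S : Finset W} {i j : W} (hi : i ∉ S)
    (hj : j ∉ S) (hci : Γ.IsClique (nbrs Γ i S : Set W)) (hcj : Γ.IsClique (nbrs Γ j S : Set W))
    {T : List W} (hT : T ∈ oddTails Γ S j i) : far Γ (j :: T) S = far Γ T S := by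
  rw [mem_oddTails hΓ hi hj hci] at hT
  obtain ⟨hS, hp, hm, -⟩ := hT
  exact far_cons_of_isClique hj hcj (List.getElem_mem hm.1)
    (mem_nbrs.2 ⟨hS _ (List.getElem_mem hm.1), (hm.2 0 hm.1).2 rfl⟩)

/-- Here `i` meets only the far end of `T`, so `i`, `j` and `T` close up to a hole of length
`T.length + 2`. -/
theorem odd_length_of_reversed (hΓ : ClawFree Γ) (hE : EvenHoleFree Γ) {S : Finset W} {i j : W}
    (hij : Γ.Adj i j) (hi : i ∉ S) (hj : j ∉ S) (hci : Γ.IsClique (nbrs Γ i S : Set W))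
    {T : List W} (hT : T ∈ oddTails Γ S j i) (hn : ¬ MeetsOnlyAt Γ i T 0) : Odd T.length := by
  rw [mem_oddTails hΓ hi hj hci] at hT
  obtain ⟨hS, hp, hm, hmi⟩ := hT
  have hmi := hmi.resolve_left hn
  have hjT : j ∉ T := fun h => hj (hS _ h)
  have hlen : 2 ≤ T.length := by
    have := hm.1
    by_contra! hlt
    exact hn (by rwa [show T.length - 1 = 0 by omega] at hmi)
  have hpath : IsInducedPath Γ (j :: T) := (isInducedPath_cons hp.1).2 ⟨hjT, hm, hp⟩
  have hcyc := cycleGraph_isIndContained hpath (c := i)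
    (by
      rw [List.mem_cons, not_or]
      exact ⟨hij.ne, fun h => hi (hS _ h)⟩)
    (by simp; omega)
    (by
      rintro (_ | k) hk
      · simpa using hij
      · simp only [List.getElem_cons_succ, List.length_cons]
        rw [hmi.2]; omega)
  by_contra hodd
  rw [Nat.not_odd_iff_even] at hodd
  refine hE _ ?_ ?_ hcyc
  · simp; omega
  · rw [List.length_cons]
    obtain ⟨t, ht⟩ := hodd
    exact ⟨t + 1, by omega⟩

end Tails

/-! ### Path sums in a Clifford family: anticommutators and the commutator with the Hamiltonian -/

section Operators

variable {W : Type*} {Γ : SimpleGraph W} {R : Type*} [CommRing R] {B : Type*} [Ring B]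
  [Algebra R B]

/-- Operators attached to the vertices of a graph, with squares `β`, that anticommute along edges
and commute otherwise. -/
structure IsCliffordFamily (Γ : SimpleGraph W) (β : W → R) (op : W → B) : Prop where
  sq : ∀ v, op v * op v = algebraMap R B (β v)
  anti : ∀ v w, Γ.Adj v w → op v * op w = -(op w * op v)
  comm : ∀ v w, ¬ Γ.Adj v w → op v * op w = op w * op v

variable {β : W → R} {op : W → B}

theorem IsCliffordFamily.prod_mul (h : IsCliffordFamily Γ β op) (v : W) (L : List W) :
    (L.map op).prod * op v =
      (-1) ^ (L.countP fun x => decide (Γ.Adj v x)) * (op v * (L.map op).prod) := by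
  induction L with
  | nil => simp
  | cons x L ih =>
    have hc : Commute ((-1 : B) ^ (L.countP fun x => decide (Γ.Adj v x))) (op x) :=
      (Commute.neg_one_left _).pow_left _
    rw [List.map_cons, List.prod_cons, mul_assoc, ih, ← mul_assoc, ← hc.eq, List.countP_cons]
    by_cases hvx : Γ.Adj v x
    · rw [if_pos (by simpa using hvx), pow_succ]
      rw [← mul_assoc (op v), h.anti v x hvx]
      simp only [mul_assoc, neg_mul, mul_neg, one_mul, neg_neg]
    · rw [if_neg (by simpa using hvx), add_zero, ← mul_assoc (op v), h.comm v x hvx]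
      simp only [mul_assoc]

/-- Only consecutive factors anticommute, so each of the `L.length - 1` edges contributes one sign.
-/
theorem IsCliffordFamily.prod_reverse (h : IsCliffordFamily Γ β op) {L : List W}
    (hL : IsInducedPath Γ L) :
    (L.reverse.map op).prod = (-1) ^ (L.length - 1) * (L.map op).prod := by
  induction L with
  | nil => simp
  | cons x T ih =>
    by_cases hT : T = []
    · subst hT; simp
    · obtain ⟨-, hm, hp⟩ := (isInducedPath_cons hT).1 hL
      have hlen : T.length = T.length - 1 + 1 := by have := hm.1; omega
      rw [List.reverse_cons, List.map_append, List.prod_append, ih hp, List.map_singleton,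
        List.prod_singleton, mul_assoc, h.prod_mul, hm.countP_eq_one hp.2.1, List.length_cons,
        Nat.add_sub_cancel, List.map_cons, List.prod_cons]
      conv_rhs => rw [hlen]
      rw [pow_succ, pow_succ, pow_zero, one_mul, mul_assoc]

variable [Fintype W]

/-- The weight `-u² β_j` of a vertex in the independence polynomial. -/
def wt (β : W → R) (u : R) (j : W) : R := -(u ^ 2 * β j)

/-- The scalar coefficient of the path `v :: T` in `S`. -/
def pathCoeff (Γ : SimpleGraph W) (β : W → R) (u : R) (S : Finset W) (v : W) (T : List W) : R :=
  (-u) ^ T.length * wIndep Γ (wt β u) (far Γ (v :: T) S)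

/-- The weighted sum of the path products over the induced paths from `v` through `S`. -/
def pathSum (Γ : SimpleGraph W) (β : W → R) (op : W → B) (u : R) (S : Finset W) (v : W) : B :=
  ∑ T ∈ tails Γ S v, pathCoeff Γ β u S v T • (op v * (T.map op).prod)

variable (u : R)

/-- Splitting off the first step gives the operator counterpart of `wIndep_eq_rest`. -/
theorem pathSum_eq {S : Finset W} {v : W} (hv : v ∉ S) :
    pathSum Γ β op u S v = op v * (algebraMap R B (wIndep Γ (wt β u) (rest Γ v S)) -
      u • ∑ j ∈ nbrs Γ v S, pathSum Γ β op u (rest Γ v S) j) := by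
  rw [pathSum, sum_tails hv, mul_sub, sub_eq_add_neg]
  congr 1
  · simp [pathCoeff, far_singleton hv, Algebra.smul_def, Algebra.commutes]
  · rw [Finset.smul_sum, Finset.mul_sum, ← Finset.sum_neg_distrib]
    refine Finset.sum_congr rfl fun j _ => ?_
    rw [pathSum, Finset.smul_sum, Finset.mul_sum, ← Finset.sum_neg_distrib]
    refine Finset.sum_congr rfl fun T _ => ?_
    rw [pathCoeff, pathCoeff, far_cons hv, List.length_cons, pow_succ, List.map_cons,
      List.prod_cons, smul_smul, mul_smul_comm, ← neg_smul]
    congr 1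
    ring

/-- A nonempty continuation contains exactly one neighbour of `v`, so its product anticommutes with
`op v` and its contribution cancels. Only the trivial path remains. -/
theorem IsCliffordFamily.anticomm_pathSum_self (h : IsCliffordFamily Γ β op) {S : Finset W}
    {v : W} (hv : v ∉ S) :
    op v * pathSum Γ β op u S v + pathSum Γ β op u S v * op v =
      algebraMap R B (2 * (β v * wIndep Γ (wt β u) (rest Γ v S))) := by
  rw [pathSum, Finset.mul_sum, Finset.sum_mul, ← Finset.sum_add_distrib,
    Finset.sum_eq_single_of_mem []]
  · simp only [pathCoeff, far_singleton hv, List.length_nil, pow_zero, one_mul, List.map_nil,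
      List.prod_nil, mul_one, mul_smul_comm, smul_mul_assoc, h.sq]
    rw [← two_mul, Algebra.smul_def, ← map_mul, ← map_ofNat (algebraMap R B), ← map_mul,
      mul_comm (β v)]
  · simp [mem_tails, isInducedPath_singleton]
  · intro T hT hne
    obtain ⟨-, hm, hp⟩ := (isInducedPath_cons hne).1 (mem_tails.1 hT).1
    rw [mul_smul_comm, smul_mul_assoc, ← smul_add, mul_assoc (op v), h.prod_mul,
      hm.countP_eq_one hp.2.1]
    simp

/-- Since `op i` already anticommutes with `op j`, a term survives exactly when the continuation
supplies an odd number of further signs. -/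
theorem IsCliffordFamily.anticomm_pathSum (h : IsCliffordFamily Γ β op) {S : Finset W} {i j : W}
    (hij : Γ.Adj i j) :
    op i * pathSum Γ β op u S j + pathSum Γ β op u S j * op i =
      ∑ T ∈ oddTails Γ S j i, (2 * pathCoeff Γ β u S j T) • (op i * op j * (T.map op).prod) := by
  rw [pathSum, Finset.mul_sum, Finset.sum_mul, ← Finset.sum_add_distrib, oddTails,
    Finset.sum_filter]
  refine Finset.sum_congr rfl fun T _ => ?_
  have hji : op j * op i = -(op i * op j) := h.anti j i hij.symm
  rw [mul_smul_comm, smul_mul_assoc, ← smul_add, mul_assoc (op j), h.prod_mul]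
  split_ifs with hodd
  · rw [hodd.neg_one_pow, neg_one_mul, mul_neg, ← mul_assoc, ← mul_assoc, hji, neg_mul, neg_neg,
      ← two_mul, mul_comm (2 : R), mul_smul, ofNat_smul_eq_nsmul, nsmul_eq_mul]
    rfl
  · rw [Nat.not_odd_iff_even] at hodd
    rw [hodd.neg_one_pow, one_mul, ← mul_assoc, ← mul_assoc, hji, neg_mul, add_neg_cancel,
      smul_zero]

/-- The map `flip` pairs the surviving terms; coefficients and products along the continuations
agree, while `op i * op j` and `op j * op i` differ by a sign. -/
theorem IsCliffordFamily.anticomm_pathSum_add (h : IsCliffordFamily Γ β op) (hΓ : ClawFree Γ)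
    (hE : EvenHoleFree Γ) {S : Finset W} {i j : W} (hij : Γ.Adj i j) (hi : i ∉ S) (hj : j ∉ S)
    (hci : Γ.IsClique (nbrs Γ i S : Set W)) (hcj : Γ.IsClique (nbrs Γ j S : Set W)) :
    (op i * pathSum Γ β op u S j + pathSum Γ β op u S j * op i) +
      (op j * pathSum Γ β op u S i + pathSum Γ β op u S i * op j) = 0 := by
  rw [h.anticomm_pathSum u hij, h.anticomm_pathSum u hij.symm, add_eq_zero_iff_eq_neg,
    ← Finset.sum_neg_distrib]
  refine Finset.sum_nbij' (flip Γ i) (flip Γ j)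
    (fun T hT => (flip_mem_oddTails hΓ hi hj hci hcj hT).1)
    (fun T hT => (flip_mem_oddTails hΓ hj hi hcj hci hT).1)
    (fun T hT => (flip_mem_oddTails hΓ hi hj hci hcj hT).2)
    (fun T hT => (flip_mem_oddTails hΓ hj hi hcj hci hT).2) fun T hT => ?_
  have hT' := (flip_mem_oddTails hΓ hi hj hci hcj hT).1
  have hprod : ((flip Γ i T).map op).prod = (T.map op).prod := by
    unfold flip
    split_ifs with hn
    · rfl
    · have hodd := odd_length_of_reversed hΓ hE hij hi hj hci hT hn
      rw [h.prod_reverse ((mem_oddTails hΓ hi hj hci).1 hT).2.1,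
        (Nat.Odd.sub_odd hodd odd_one).neg_one_pow, one_mul]
  rw [pathCoeff, pathCoeff, far_cons_of_mem_oddTails hΓ hi hj hci hcj hT,
    far_cons_of_mem_oddTails hΓ hj hi hcj hci hT', far_flip, length_flip, hprod,
    h.anti i j hij, neg_mul, smul_neg]

/-- The anticommutators along a clique add up to a scalar. -/
theorem IsCliffordFamily.sum_anticomm_pathSum (h : IsCliffordFamily Γ β op) (hΓ : ClawFree Γ)
    (hE : EvenHoleFree Γ) {S K : Finset W} (hK : Γ.IsClique (K : Set W)) (hd : Disjoint S K)
    (hc : ∀ j ∈ K, Γ.IsClique (nbrs Γ j S : Set W)) :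
    (∑ i ∈ K, op i) * (∑ j ∈ K, pathSum Γ β op u S j) +
      (∑ j ∈ K, pathSum Γ β op u S j) * (∑ i ∈ K, op i) =
      algebraMap R B (2 * ∑ j ∈ K, β j * wIndep Γ (wt β u) (rest Γ j S)) := by
  induction K using Finset.induction_on with
  | empty => simp
  | insert k K hk ih =>
    rw [Finset.coe_insert, SimpleGraph.isClique_insert] at hK
    rw [Finset.disjoint_insert_right] at hd
    have hcross : (op k * (∑ j ∈ K, pathSum Γ β op u S j) +
        (∑ j ∈ K, pathSum Γ β op u S j) * op k) +
        ((∑ i ∈ K, op i) * pathSum Γ β op u S k + pathSum Γ β op u S k * ∑ i ∈ K, op i) = 0 := by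
      simp only [Finset.mul_sum, Finset.sum_mul, ← Finset.sum_add_distrib]
      refine Finset.sum_eq_zero fun j hj => ?_
      exact h.anticomm_pathSum_add u hΓ hE (hK.2 j hj (by rintro rfl; exact hk hj)) hd.1
        (fun hjS => Finset.disjoint_left.1 hd.2 hjS hj) (hc k (Finset.mem_insert_self _ _))
        (hc j (Finset.mem_insert_of_mem hj))
    have hih := ih hK.1 hd.2 fun j hj => hc j (Finset.mem_insert_of_mem hj)
    have hself := h.anticomm_pathSum_self u hd.1
    rw [Finset.sum_insert hk, Finset.sum_insert hk, Finset.sum_insert hk, mul_add (2 : R),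
      map_add, ← hih, ← hself, ← sub_eq_zero, ← hcross]
    noncomm_ring

/-- The commutator of the Hamiltonian with the path sum: up to a multiple of the operator at the
starting vertex, the path sum is an eigenvector. -/
theorem IsCliffordFamily.commutator_pathSum (h : IsCliffordFamily Γ β op) (hΓ : ClawFree Γ)
    (hE : EvenHoleFree Γ) (S : Finset W) (v : W) (hv : v ∉ S)
    (hc : Γ.IsClique (nbrs Γ v S : Set W)) :
    u • ((∑ i ∈ S, op i) * pathSum Γ β op u S v - pathSum Γ β op u S v * ∑ i ∈ S, op i) =
      (2 : R) • (pathSum Γ β op u S v - wIndep Γ (wt β u) S • op v) := by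
  induction hn : S.card using Nat.strong_induction_on generalizing S v with
  | _ n ih =>
    subst hn
    set S' := rest Γ v S with hS'
    set K := nbrs Γ v S with hKdef
    have hdisj : Disjoint S' K := disjoint_rest_nbrs v S
    have hsum : ∑ i ∈ S, op i = ∑ i ∈ S', op i + ∑ i ∈ K, op i := by
      rw [← Finset.sum_union hdisj, rest_union_nbrs]
    have hcl : ∀ j ∈ K, Γ.IsClique (nbrs Γ j S' : Set W) :=
      fun j hj => hΓ.isClique_nbrs_rest hv hj
    have hanti := h.sum_anticomm_pathSum u hΓ hE hc hdisj hcl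
    have hrec : u • ((∑ i ∈ S', op i) * (∑ j ∈ K, pathSum Γ β op u S' j) -
        (∑ j ∈ K, pathSum Γ β op u S' j) * ∑ i ∈ S', op i) =
        (2 : R) • ((∑ j ∈ K, pathSum Γ β op u S' j) -
          wIndep Γ (wt β u) S' • ∑ j ∈ K, op j) := by
      rw [Finset.mul_sum, Finset.sum_mul, ← Finset.sum_sub_distrib, Finset.smul_sum,
        Finset.smul_sum, ← Finset.sum_sub_distrib, Finset.smul_sum]
      refine Finset.sum_congr rfl fun j hj => ?_
      have hjS : j ∈ S := (mem_nbrs.1 hj).1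
      have hjS' : j ∉ S' := fun hj' => Finset.disjoint_left.1 hdisj hj' hj
      refine ih _ (Finset.card_lt_card ?_) S' j hjS' (hcl j hj) rfl
      exact Finset.ssubset_iff_subset_ne.2 ⟨rest_subset v S, fun heq => hjS' (heq ▸ hjS)⟩
    have hcomm : (∑ i ∈ S', op i) * op v = op v * ∑ i ∈ S', op i := by
      rw [Finset.mul_sum, Finset.sum_mul]
      exact Finset.sum_congr rfl fun i hi => (h.comm v i (mem_rest.1 hi).2).symm
    have hacomm : (∑ i ∈ K, op i) * op v = -(op v * ∑ i ∈ K, op i) := by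
      rw [Finset.mul_sum, Finset.sum_mul, ← Finset.sum_neg_distrib]
      exact Finset.sum_congr rfl fun i hi => h.anti i v (mem_nbrs.1 hi).2.symm
    have hpoly : wIndep Γ (wt β u) S = wIndep Γ (wt β u) S' -
        u ^ 2 * ∑ j ∈ K, β j * wIndep Γ (wt β u) (rest Γ j S') := by
      rw [wIndep_eq_rest (wt β u) hc, Finset.mul_sum, sub_eq_add_neg, ← Finset.sum_neg_distrib]
      congr 1
      exact Finset.sum_congr rfl fun j _ => by rw [wt]; ring
    rw [pathSum_eq u hv, ← hS', ← hKdef, hsum, hpoly]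
    generalize (∑ i ∈ S', op i) = H at *
    generalize (∑ i ∈ K, op i) = k at *
    generalize (∑ j ∈ K, pathSum Γ β op u S' j) = Φ at *
    generalize (∑ j ∈ K, β j * wIndep Γ (wt β u) (rest Γ j S')) = s at *
    generalize wIndep Γ (wt β u) S' = p at *
    generalize op v = x at *
    -- Moving `x` to the left past `H + k` flips the sign of `k`. The part of the commutator coming
    -- from `k` and `Φ` thereby becomes an anticommutator, which `hanti` evaluates to a scalar.
    have e1 : (H + k) * (x * (algebraMap R B p - u • Φ)) - x * (algebraMap R B p - u • Φ) * (H + k)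
        = x * (u • (k * Φ + Φ * k) - u • (H * Φ - Φ * H) - (2 : R) • (p • k)) := by
      have hx1 : (H + k) * (x * (algebraMap R B p - u • Φ)) =
          x * ((H - k) * (algebraMap R B p - u • Φ)) := by
        rw [← mul_assoc, add_mul, hcomm, hacomm, ← sub_eq_add_neg, ← mul_sub, mul_assoc]
      rw [hx1, mul_assoc, ← mul_sub]
      congr 1
      simp only [mul_sub, sub_mul, mul_add, mul_smul_comm, smul_mul_assoc, smul_sub,
        smul_add, two_smul, ← Algebra.commutes p, ← Algebra.smul_def]
      abel
    rw [e1, hanti, hrec, ← mul_smul_comm]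
    have e2 : p • x = x * algebraMap R B p := by rw [Algebra.smul_def, Algebra.commutes]
    have e3 : (p - u ^ 2 * s) • x = x * algebraMap R B (p - u ^ 2 * s) := by
      rw [Algebra.smul_def, Algebra.commutes]
    rw [e3, ← mul_sub, ← mul_smul_comm]
    congr 1
    simp only [Algebra.algebraMap_eq_smul_one, smul_sub, sub_smul, smul_smul]
    module

end Operators

/-! ### Scalar anticommutators from the commutator identity -/

section Anticommutation

variable {A : Type*} [Ring A] [Algebra ℂ A]

/-- Operators generated from `χ` by repeated commutators with `H`, up to multiples of `χ`, have
scalar anticommutators as soon as their anticommutators with `χ` are scalar. -/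
theorem exists_anticomm_eq_algebraMap {H χ : A} {Ψ : ℕ → A} {p q : ℕ → ℂ}
    (hzero : Ψ 0 = p 0 • χ) (hsucc : ∀ n, Ψ (n + 1) =
      (1 / 2 : ℂ) • (H * Ψ n - Ψ n * H) + p (n + 1) • χ)
    (hχ : ∀ n, χ * Ψ n + Ψ n * χ = algebraMap ℂ A (q n)) (m n : ℕ) :
    ∃ t : ℂ, Ψ m * Ψ n + Ψ n * Ψ m = algebraMap ℂ A t := by
  induction m generalizing n with
  | zero =>
    refine ⟨p 0 * q n, ?_⟩
    rw [hzero, smul_mul_assoc, mul_smul_comm, ← smul_add, hχ, map_mul, Algebra.smul_def]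
  | succ m ih =>
    obtain ⟨t, ht⟩ := ih n
    obtain ⟨s, hs⟩ := ih (n + 1)
    refine ⟨p (m + 1) * q n - s + p (n + 1) * q m, ?_⟩
    have hcomm := Algebra.commutes t H
    rw [← ht] at hcomm
    have e1 : Ψ (m + 1) * Ψ n + Ψ n * Ψ (m + 1) =
        (1 / 2 : ℂ) • ((H * Ψ m - Ψ m * H) * Ψ n + Ψ n * (H * Ψ m - Ψ m * H)) +
          p (m + 1) • (χ * Ψ n + Ψ n * χ) := by
      rw [hsucc, add_mul, mul_add, smul_mul_assoc, smul_mul_assoc, mul_smul_comm, mul_smul_comm]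
      module
    have e2 : Ψ m * Ψ (n + 1) + Ψ (n + 1) * Ψ m =
        (1 / 2 : ℂ) • (Ψ m * (H * Ψ n - Ψ n * H) + (H * Ψ n - Ψ n * H) * Ψ m) +
          p (n + 1) • (χ * Ψ m + Ψ m * χ) := by
      rw [hsucc, add_mul, mul_add, smul_mul_assoc, smul_mul_assoc, mul_smul_comm, mul_smul_comm]
      module
    -- The scalar `{Ψ m, Ψ n}` commutes with `H`, so by the Leibniz rule the commutator shifts from
    -- `Ψ m` to `Ψ n` with a sign.
    have e3 : (H * Ψ m - Ψ m * H) * Ψ n + Ψ n * (H * Ψ m - Ψ m * H) =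
        -(Ψ m * (H * Ψ n - Ψ n * H) + (H * Ψ n - Ψ n * H) * Ψ m) := by
      rw [← sub_eq_zero, sub_neg_eq_add]
      rw [← sub_eq_zero] at hcomm
      rw [← neg_eq_zero, ← hcomm]
      noncomm_ring
    rw [hs, hχ] at e2
    rw [e1, e3, hχ, smul_neg, ← sub_eq_iff_eq_add.2 e2, map_add, map_sub, map_mul, map_mul,
      ← Algebra.smul_def, ← Algebra.smul_def]
    abel

attribute [local instance] Polynomial.algebra

/-- Evaluation of a polynomial with coefficients in a complex algebra at a complex number. -/
def evalAt (A : Type*) [Ring A] [Algebra ℂ A] (u : ℂ) : A[X] →+* A :=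
  eval₂RingHom' (RingHom.id A) (algebraMap ℂ A u) fun a => (Algebra.commutes u a).symm

theorem evalAt_C (u : ℂ) (a : A) : evalAt A u (C a) = a := by
  simp [evalAt, eval₂RingHom']

theorem evalAt_smul (u : ℂ) (c : ℂ[X]) (p : A[X]) : evalAt A u (c • p) = c.eval u • evalAt A u p := by
  have : evalAt A u (algebraMap ℂ[X] A[X] c) = algebraMap ℂ A (c.eval u) := by
    simp only [evalAt, eval₂RingHom', Polynomial.algebraMap_def, coe_mapRingHom, RingHom.coe_mk,
      MonoidHom.coe_mk, OneHom.coe_mk]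
    rw [eval₂_map, RingHom.id_comp, eval₂_at_apply]
  rw [Algebra.smul_def, map_mul, this, Algebra.smul_def]

theorem evalAt_eq_sum (u : ℂ) (p : A[X]) :
    evalAt A u p = ∑ n ∈ Finset.range (p.natDegree + 1), u ^ n • p.coeff n := by
  have h : evalAt A u p = p.eval (algebraMap ℂ A u) := rfl
  rw [h, eval_eq_sum_range]
  refine Finset.sum_congr rfl fun n _ => ?_
  rw [← map_pow, Algebra.smul_def, Algebra.commutes]

theorem coeff_smul_C (c : ℂ[X]) (a : A) (n : ℕ) : (c • C a).coeff n = c.coeff n • a := by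
  rw [Algebra.smul_def, coeff_mul_C, Polynomial.algebraMap_def, coe_mapRingHom, coeff_map,
    Algebra.smul_def]

section

variable {H χ : A} {Ψ : A[X]} {P Q : ℂ[X]}
  (hcomm : (X : ℂ[X]) • (C H * Ψ - Ψ * C H) = (2 : ℂ[X]) • (Ψ - P • C χ))
  (hχ : C χ * Ψ + Ψ * C χ = algebraMap ℂ[X] A[X] (2 * Q))

include hcomm hχ

/-- Comparing coefficients in `hcomm`, where the factor `X` shifts the degree by one, gives the
recursion of `exists_anticomm_eq_algebraMap`. -/
theorem exists_coeff_anticomm (m n : ℕ) :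
    ∃ t : ℂ, Ψ.coeff m * Ψ.coeff n + Ψ.coeff n * Ψ.coeff m = algebraMap ℂ A t := by
  have h2 : (2 : ℂ[X]) • (Ψ - P • C χ) = (2 : ℂ) • (Ψ - P • C χ) := by
    rw [two_smul, two_smul]
  have hX : ∀ p : A[X], (X : ℂ[X]) • p = p * X := fun p => by
    rw [Algebra.smul_def, Polynomial.algebraMap_def, coe_mapRingHom, map_X, X_mul]
  rw [h2, hX] at hcomm
  have hcoeff := fun n => congrArg (fun p : A[X] => p.coeff n) hcomm
  refine exists_anticomm_eq_algebraMap (H := H) (χ := χ) (Ψ := Ψ.coeff) (p := P.coeff)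
    (q := fun n => 2 * Q.coeff n) ?_ ?_ ?_ m n
  · have := hcoeff 0
    simp only [mul_coeff_zero, coeff_X_zero, mul_zero, coeff_smul, coeff_sub, coeff_smul_C] at this
    exact sub_eq_zero.1 ((smul_eq_zero.1 this.symm).resolve_left two_ne_zero)
  · intro k
    have := hcoeff (k + 1)
    simp only [coeff_mul_X, coeff_sub, coeff_C_mul, coeff_mul_C, coeff_smul, coeff_smul_C] at this
    rw [this]
    module
  · intro k
    have := congrArg (fun p : A[X] => p.coeff k) hχ
    simp only [coeff_add, coeff_C_mul, coeff_mul_C, Polynomial.algebraMap_def, coe_mapRingHom,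
      coeff_map] at this
    rw [this, coeff_ofNat_mul]

/-- That the scalar depends polynomially on `v` is what later allows differentiation at `v = -u`. -/
theorem exists_evalAt_anticomm (u : ℂ) :
    ∃ T : ℂ[X], ∀ v : ℂ, evalAt A u Ψ * evalAt A v Ψ + evalAt A v Ψ * evalAt A u Ψ =
      algebraMap ℂ A (T.eval v) := by
  choose t ht using exists_coeff_anticomm hcomm hχ
  refine ⟨∑ n ∈ Finset.range (Ψ.natDegree + 1),
    C (∑ m ∈ Finset.range (Ψ.natDegree + 1), u ^ m * t m n) * X ^ n, fun v => ?_⟩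
  rw [evalAt_eq_sum u, evalAt_eq_sum v, Finset.sum_mul_sum, Finset.sum_mul_sum,
    Finset.sum_comm, ← Finset.sum_add_distrib, eval_finsetSum, map_sum]
  refine Finset.sum_congr rfl fun n _ => ?_
  rw [← Finset.sum_add_distrib, eval_mul, eval_C, eval_pow, eval_X, Finset.sum_mul, map_sum]
  refine Finset.sum_congr rfl fun m _ => ?_
  rw [smul_mul_smul_comm, smul_mul_smul_comm, mul_comm (v ^ n), ← smul_add, ht, Algebra.smul_def,
    ← map_mul]
  congr 1
  ring

/-- Expand the commutator of `H` with the scalar `{Ψ(u), Ψ(v)}`, multiplied by `u * v`, and insert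
`hcomm` at `u` and at `v`. -/
theorem add_smul_evalAt_anticomm (u v : ℂ) :
    (u + v) • (evalAt A u Ψ * evalAt A v Ψ + evalAt A v Ψ * evalAt A u Ψ) =
      algebraMap ℂ A (2 * (v * P.eval u * Q.eval v + u * P.eval v * Q.eval u)) := by
  obtain ⟨T, hT⟩ := exists_evalAt_anticomm hcomm hχ u
  have hH := Algebra.commutes (T.eval v) H
  rw [← hT] at hH
  have hc : ∀ w : ℂ, w • (H * evalAt A w Ψ - evalAt A w Ψ * H) =
      (2 : ℂ) • (evalAt A w Ψ - P.eval w • χ) := fun w => by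
    simpa only [evalAt_smul, map_sub, map_mul, evalAt_C, eval_X, eval_ofNat] using
      congrArg (evalAt A w) hcomm
  have hx : ∀ w : ℂ, χ * evalAt A w Ψ + evalAt A w Ψ * χ = (2 * Q.eval w) • (1 : A) := fun w => by
    have := congrArg (evalAt A w) hχ
    rw [Algebra.algebraMap_eq_smul_one, evalAt_smul] at this
    simpa only [map_add, map_mul, map_one, evalAt_C, eval_mul, eval_ofNat] using this
  have hu := hc u
  have hv := hc v
  have xu := hx u
  have xv := hx v
  generalize evalAt A u Ψ = a at *
  generalize evalAt A v Ψ = b at *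
  generalize P.eval u = p at *
  generalize P.eval v = p' at *
  have e1 : (0 : A) = v • ((u • (H * a - a * H)) * b + b * (u • (H * a - a * H))) +
      u • (a * (v • (H * b - b * H)) + (v • (H * b - b * H)) * a) := by
    have hH := sub_eq_zero.2 hH.symm
    rw [← smul_zero (u * v), ← hH]
    simp only [smul_mul_assoc, mul_smul_comm]
    rw [← smul_add, ← smul_add, smul_smul, smul_smul, mul_comm v u, ← smul_add]
    congr 1
    noncomm_ring
  rw [hu, hv] at e1
  have e2 : v • ((2 : ℂ) • (a - p • χ) * b + b * (2 : ℂ) • (a - p • χ)) +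
      u • (a * (2 : ℂ) • (b - p' • χ) + (2 : ℂ) • (b - p' • χ) * a) =
      (2 : ℂ) • ((u + v) • (a * b + b * a) - (v * p) • (χ * b + b * χ) -
        (u * p') • (χ * a + a * χ)) := by
    simp only [sub_mul, mul_sub, smul_mul_assoc, mul_smul_comm]
    module
  rw [e2, xu, xv] at e1
  have e3 := (smul_eq_zero.1 e1.symm).resolve_left two_ne_zero
  rw [sub_sub, sub_eq_zero] at e3
  rw [e3, Algebra.algebraMap_eq_smul_one]
  module

/-- At `v = -u` the previous formula reads `0 = 0`. As an identity of polynomials in `v` it can be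
differentiated there, which removes the factor `u + v`. -/
theorem evalAt_anticomm_neg {u : ℂ} (hP : P.eval u = 0) :
    evalAt A u Ψ * evalAt A (-u) Ψ + evalAt A (-u) Ψ * evalAt A u Ψ =
      algebraMap ℂ A (2 * (u * (derivative P).eval (-u) * Q.eval u)) := by
  rcases subsingleton_or_nontrivial A with hA | hA
  · exact Subsingleton.elim _ _
  obtain ⟨T, hT⟩ := exists_evalAt_anticomm hcomm hχ u
  rw [hT]
  congr 1
  have hpoly : (C u + X) * T = C (2 * u * Q.eval u) * P := by
    refine Polynomial.funext fun v => ?_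
    have := add_smul_evalAt_anticomm hcomm hχ u v
    rw [hT, Algebra.smul_def, ← map_mul, hP] at this
    have := (algebraMap ℂ A).injective this
    simp only [eval_mul, eval_add, eval_C, eval_X, this]
    ring
  have := congrArg (fun p => (derivative p).eval (-u)) hpoly
  simp only [derivative_mul, derivative_add, derivative_C, derivative_X, zero_add, one_mul,
    eval_add, eval_mul, eval_C, eval_X, add_neg_cancel, zero_mul, add_zero] at this
  rw [this]
  ring

end

end Anticommutation

/-! ### Zeros and the Stieltjes property in the upper half-plane -/

section HalfPlane

variable {W : Type*} {Γ : SimpleGraph W}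

/-- Every union of components of `S` is met by a clique of `S` that is the neighbourhood of an
outside vertex. -/
def IsRooted (Γ : SimpleGraph W) (S : Finset W) : Prop :=
  ∀ T ⊆ S, T.Nonempty → (∀ x ∈ T, ∀ y ∈ S, Γ.Adj x y → y ∈ T) →
    ∃ v ∉ S, Γ.IsClique (nbrs Γ v S : Set W) ∧ ∃ x ∈ T, x ∈ nbrs Γ v S

/-- A union of components of the smaller set either touches a deleted neighbour `j` of `v`, which
then serves as its root, or is already closed in `S` and keeps its old root. -/
theorem IsRooted.of_rest {S : Finset W} (h : IsRooted Γ S) (hΓ : ClawFree Γ) {v : W} (hv : v ∉ S) :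
    IsRooted Γ (rest Γ v S) := by
  intro T hTS hT hclosed
  by_cases hj : ∃ j ∈ nbrs Γ v S, ∃ x ∈ T, Γ.Adj j x
  · obtain ⟨j, hj, x, hx, hjx⟩ := hj
    exact ⟨j, fun h' => (mem_rest.1 h').2 (mem_nbrs.1 hj).2, hΓ.isClique_nbrs_rest hv hj, x, hx,
      mem_nbrs.2 ⟨hTS hx, hjx⟩⟩
  · push Not at hj
    obtain ⟨v', hv', hcl, x, hx, hxn⟩ := h T (hTS.trans (rest_subset v S)) hT (by
      intro x hx y hy hxy
      by_cases hvy : Γ.Adj v y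
      · exact absurd hxy.symm (hj y (mem_nbrs.2 ⟨hy, hvy⟩) x hx)
      · exact hclosed x hx y (mem_rest.2 ⟨hy, hvy⟩) hxy)
    refine ⟨v', fun h' => hv' (rest_subset v S h'), hcl.subset ?_, x, hx,
      mem_nbrs.2 ⟨hTS hx, (mem_nbrs.1 hxn).2⟩⟩
    intro y hy
    have hy := mem_nbrs.1 (Finset.mem_coe.1 hy)
    exact Finset.mem_coe.2 (mem_nbrs.2 ⟨rest_subset v S hy.1, hy.2⟩)

variable {c : W → ℝ}

theorem inv_im_pos {g : ℂ} (hg : g.im < 0) : 0 < (g⁻¹).im := by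
  have hg0 : g ≠ 0 := by rintro rfl; simp at hg
  rw [Complex.inv_im]
  exact div_pos (by linarith) (Complex.normSq_pos.2 hg0)

/-- For a rooted set `S` of a claw-free graph the independence polynomial has no zero in the upper
half-plane, and the quotient by it of the polynomial with a simplicial clique deleted is a
Stieltjes function there. -/
theorem IsRooted.halfPlane (hΓ : ClawFree Γ) (hc : ∀ j, 0 < c j) {z : ℂ} (hz : 0 < z.im)
    {S : Finset W} (hS : IsRooted Γ S) :
    wIndep Γ (fun j => -(z * c j)) S ≠ 0 ∧
      ∀ v ∉ S, Γ.IsClique (nbrs Γ v S : Set W) →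
        0 ≤ (wIndep Γ (fun j => -(z * c j)) (rest Γ v S) /
          wIndep Γ (fun j => -(z * c j)) S).im ∧
        0 < (z * (wIndep Γ (fun j => -(z * c j)) (rest Γ v S) /
          wIndep Γ (fun j => -(z * c j)) S)).im := by
  induction hn : S.card using Nat.strong_induction_on generalizing S with
  | _ n ih =>
    subst hn
    set p : Finset W → ℂ := wIndep Γ (fun j => -(z * c j)) with hp
    -- The recursion reads `p S = p (rest Γ v S) * g` with `g = 1 - ∑ c_j z f_j`. The two bounds on
    -- the smaller quotients `f_j` put `g / z` and `g` in the lower half-plane; the new quotient is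
    -- `1 / g`, and `z` times it is `1 / (g / z)`.
    have hstep : ∀ v ∉ S, Γ.IsClique (nbrs Γ v S : Set W) → (nbrs Γ v S).Nonempty →
        p S ≠ 0 ∧ 0 < (p (rest Γ v S) / p S).im ∧ 0 < (z * (p (rest Γ v S) / p S)).im := by
      intro v hv hcl hne
      have hlt : (rest Γ v S).card < S.card := by
        obtain ⟨j, hj⟩ := hne
        refine Finset.card_lt_card (Finset.ssubset_iff_subset_ne.2 ⟨rest_subset v S, fun heq => ?_⟩)
        have := (mem_nbrs.1 hj).1
        rw [← heq] at this
        exact (mem_rest.1 this).2 (mem_nbrs.1 hj).2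
      obtain ⟨h0, hj⟩ := ih _ hlt (hS.of_rest hΓ hv) rfl
      have hj' : ∀ j ∈ nbrs Γ v S, 0 ≤ (p (rest Γ j (rest Γ v S)) / p (rest Γ v S)).im ∧
          0 < (z * (p (rest Γ j (rest Γ v S)) / p (rest Γ v S))).im := fun j hjm =>
        hj j (fun h' => (mem_rest.1 h').2 (mem_nbrs.1 hjm).2) (hΓ.isClique_nbrs_rest hv hjm)
      set f : W → ℂ := fun j => p (rest Γ j (rest Γ v S)) / p (rest Γ v S) with hf
      set g : ℂ := 1 - ∑ j ∈ nbrs Γ v S, (c j : ℂ) * (z * f j) with hg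
      have hz0 : z ≠ 0 := by rintro rfl; simp at hz
      have hpS : p S = p (rest Γ v S) * g := by
        rw [hg, mul_sub, mul_one, Finset.mul_sum, sub_eq_add_neg, ← Finset.sum_neg_distrib]
        rw [hp, wIndep_eq_rest _ hcl, ← hp]
        congr 1
        refine Finset.sum_congr rfl fun j _ => ?_
        have : p (rest Γ v S) * f j = p (rest Γ j (rest Γ v S)) := mul_div_cancel₀ _ h0
        rw [← this]
        ring
      have hgim : g.im < 0 := by
        simp only [hg, Complex.sub_im, Complex.one_im, Complex.im_sum, Complex.im_ofReal_mul]
        have : 0 < ∑ j ∈ nbrs Γ v S, c j * (z * f j).im :=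
          Finset.sum_pos (fun j hjm => mul_pos (hc j) (hj' j hjm).2) hne
        linarith
      have hgz : (g / z).im < 0 := by
        have : g / z = z⁻¹ - ∑ j ∈ nbrs Γ v S, (c j : ℂ) * f j := by
          rw [hg, sub_div, Finset.sum_div, one_div]
          congr 1
          refine Finset.sum_congr rfl fun j _ => ?_
          field_simp
        rw [this]
        simp only [Complex.sub_im, Complex.im_sum, Complex.im_ofReal_mul, Complex.inv_im]
        have h1 : 0 ≤ ∑ j ∈ nbrs Γ v S, c j * (f j).im :=
          Finset.sum_nonneg fun j hjm => mul_nonneg (hc j).le (hj' j hjm).1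
        have h2 : -z.im / Complex.normSq z < 0 :=
          div_neg_of_neg_of_pos (by linarith) (Complex.normSq_pos.2 hz0)
        linarith
      have hg0 : g ≠ 0 := by intro h; rw [h] at hgim; simp at hgim
      have hquot : p (rest Γ v S) / p S = g⁻¹ := by
        rw [hpS]; field_simp
      refine ⟨by rw [hpS]; exact mul_ne_zero h0 hg0, ?_, ?_⟩
      · rw [hquot]; exact inv_im_pos hgim
      · rw [hquot, ← div_eq_mul_inv, ← inv_div]; exact inv_im_pos hgz
    have hne : p S ≠ 0 := by
      rcases S.eq_empty_or_nonempty with rfl | hSne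
      · rw [hp, wIndep_empty]; exact one_ne_zero
      · obtain ⟨v, hv, hcl, x, -, hx⟩ := hS S subset_rfl hSne fun _ _ y hy _ => hy
        exact (hstep v hv hcl ⟨x, hx⟩).1
    refine ⟨hne, fun v hv hcl => ?_⟩
    -- Without neighbours of `v` the quotient is `1`, which is why the first bound is not strict.
    rcases (nbrs Γ v S).eq_empty_or_nonempty with hemp | hK
    · have : rest Γ v S = S := by
        have := rest_union_nbrs (Γ := Γ) v S
        rwa [hemp, Finset.union_empty] at this
      rw [this, div_self hne]
      simpa using hz
    · exact ⟨(hstep v hv hcl hK).2.1.le, (hstep v hv hcl hK).2.2⟩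

end HalfPlane

/-! ### Sign of the residue at a simple real pole -/

section Residue

open Filter Topology

/-- The residue at a simple real pole of a quotient of real polynomials that maps the upper
half-plane to itself is negative. -/
theorem eval_mul_derivative_neg {p d : ℝ[X]} {x : ℝ}
    (him : ∀ z : ℂ, 0 < z.im → 0 ≤ (aeval z d / aeval z p).im) (hp : p.eval x = 0)
    (hp' : (derivative p).eval x ≠ 0) (hd : d.eval x ≠ 0) :
    d.eval x * (derivative p).eval x < 0 := by
  obtain ⟨q, rfl⟩ := dvd_iff_isRoot.2 hp
  have hq : (derivative ((X - C x) * q)).eval x = q.eval x := by simp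
  rw [hq] at hp' ⊢
  have hcont : Tendsto (fun ε : ℝ => (aeval ((x : ℂ) + ε * Complex.I) d /
      aeval ((x : ℂ) + ε * Complex.I) q).re) (𝓝[>] 0) (𝓝 (d.eval x / q.eval x)) := by
    have hev : ∀ r : ℝ[X], aeval ((x : ℂ) + (0 : ℝ) * Complex.I) r = ((r.eval x : ℝ) : ℂ) := by
      intro r
      rw [Complex.ofReal_zero, zero_mul, add_zero]
      exact aeval_algebraMap_apply_eq_algebraMap_eval x r
    have hz : Continuous fun ε : ℝ => (x : ℂ) + ε * Complex.I := by fun_prop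
    have hc : ContinuousAt (fun ε : ℝ => (aeval ((x : ℂ) + ε * Complex.I) d /
        aeval ((x : ℂ) + ε * Complex.I) q).re) 0 := by
      refine Complex.continuous_re.continuousAt.comp (ContinuousAt.div ?_ ?_ ?_)
      · exact (d.continuous_aeval.comp hz).continuousAt
      · exact (q.continuous_aeval.comp hz).continuousAt
      · rw [hev]; exact_mod_cast hp'
    have := hc.tendsto.mono_left (nhdsWithin_le_nhds (s := Set.Ioi 0))
    rw [hev, hev, ← Complex.ofReal_div, Complex.ofReal_re] at this
    exact this
  have hle : d.eval x / q.eval x ≤ 0 := by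
    refine le_of_tendsto hcont ?_
    filter_upwards [self_mem_nhdsWithin] with ε hε
    have hε : 0 < ε := hε
    have h := him (x + ε * Complex.I) (by simpa using hε)
    have hsplit : aeval ((x : ℂ) + ε * Complex.I) d /
        aeval ((x : ℂ) + ε * Complex.I) ((X - C x) * q) =
        ((ε⁻¹ : ℝ) : ℂ) * (-Complex.I * (aeval ((x : ℂ) + ε * Complex.I) d /
          aeval ((x : ℂ) + ε * Complex.I) q)) := by
      have h1 : aeval ((x : ℂ) + ε * Complex.I) (X - C x) = ε * Complex.I := by simp
      rw [map_mul, h1, div_mul_eq_div_div_swap, div_mul_eq_div_div_swap, Complex.div_I]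
      push_cast
      ring
    rw [hsplit, Complex.im_ofReal_mul] at h
    have h2 := nonneg_of_mul_nonneg_right h (inv_pos.2 hε)
    simp only [neg_mul, Complex.neg_im, Complex.mul_im, Complex.I_re, Complex.I_im, zero_mul,
      one_mul, zero_add] at h2
    linarith
  rcases lt_or_gt_of_ne hp' with h | h
  · have : 0 < d.eval x := by
      refine lt_of_le_of_ne ?_ hd.symm
      by_contra! hneg
      exact absurd hle (not_le.2 (div_pos_of_neg_of_neg hneg h))
    exact mul_neg_of_pos_of_neg this h
  · have : d.eval x < 0 := by
      refine lt_of_le_of_ne ?_ hd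
      by_contra! hpos
      exact absurd hle (not_le.2 (div_pos hpos h))
    exact mul_neg_of_neg_of_pos this h

end Residue

/-! ### The extended graph, and passage between its vertices and those of `G` -/

section Transport

variable {V : Type*} {G : SimpleGraph V} {K : Finset V}

@[simp] theorem extendedGraph_adj_some {i j : V} :
    (extendedGraph G K).Adj (some i) (some j) ↔ G.Adj i j := Iff.rfl

@[simp] theorem extendedGraph_adj_none_some {j : V} :
    (extendedGraph G K).Adj none (some j) ↔ j ∈ K := Iff.rfl

/-- The two neighbours of the new vertex on a hole would lie in the clique, hence be adjacent, and
give the hole a chord. -/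
theorem EvenHoleFree.extendedGraph (hG : EvenHoleFree G) (hK : G.IsClique (K : Set V)) :
    EvenHoleFree (extendedGraph G K) := by
  rintro n hn heven ⟨f⟩
  by_cases hnone : ∃ i, f i = none
  · obtain ⟨i, hi⟩ := hnone
    have : NeZero n := ⟨by omega⟩
    obtain ⟨m, rfl⟩ : ∃ m, n = m + 4 := ⟨n - 4, by omega⟩
    have hadj : ∀ j, (SimpleGraph.cycleGraph (m + 4)).Adj i j → ∃ x ∈ K, f j = some x := by
      intro j hj
      have := f.map_rel_iff.2 hj
      rw [hi] at this
      cases hfj : f j with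
      | none => rw [hfj] at this; exact this.elim
      | some x => rw [hfj] at this; exact ⟨x, this, rfl⟩
    obtain ⟨x, hx, hfx⟩ := hadj (i + 1) (by simp [SimpleGraph.cycleGraph_adj])
    obtain ⟨y, hy, hfy⟩ := hadj (i - 1) (by simp [SimpleGraph.cycleGraph_adj])
    -- The vertices `i + 1` and `i - 1` differ by two; in a cycle of length at least four this makes
    -- them distinct and non-adjacent.
    have h2 : (1 + 1 : Fin (m + 4)) ≠ 0 := by
      rw [Ne, Fin.ext_iff]
      simp [Fin.val_add, Nat.mod_eq_of_lt (show 2 < m + 4 by omega)]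
    have h21 : (1 + 1 : Fin (m + 4)) ≠ 1 := by
      rw [Ne, Fin.ext_iff]
      simp [Fin.val_add, Nat.mod_eq_of_lt (show 2 < m + 4 by omega)]
    have h31 : -(1 + 1 : Fin (m + 4)) ≠ 1 := by
      rw [Ne, neg_eq_iff_add_eq_zero, Fin.ext_iff]
      simp [Fin.val_add, Nat.mod_eq_of_lt (show 3 < m + 4 by omega)]
    have hne : i + 1 ≠ i - 1 := by
      intro h
      apply h2
      have : i + 1 - (i - 1) = 0 := sub_eq_zero.2 h
      rw [← this]; abel
    have hxy : x ≠ y := by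
      rintro rfl
      exact hne (f.injective (hfx.trans hfy.symm))
    have hadj' : (SimpleGraph.cycleGraph (m + 4)).Adj (i + 1) (i - 1) := by
      rw [← f.map_rel_iff, hfx, hfy]
      exact hK hx hy hxy
    rw [SimpleGraph.cycleGraph_adj] at hadj'
    have e1 : i + 1 - (i - 1) = 1 + 1 := by abel
    have e2 : i - 1 - (i + 1) = -(1 + 1) := by abel
    rw [e1, e2] at hadj'
    exact hadj'.elim h21 h31
  · push Not at hnone
    have hsome : ∀ i, ∃ x, f i = some x := fun i => Option.ne_none_iff_exists'.1 (hnone i)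
    choose g hg using hsome
    refine hG n hn heven ⟨⟨⟨g, fun i j hij => f.injective (by rw [hg, hg, hij])⟩, fun {i j} => ?_⟩⟩
    rw [← f.map_rel_iff, hg, hg]
    rfl

theorem mem_map_some {S : Finset V} {x : Option V} :
    x ∈ S.map Function.Embedding.some ↔ ∃ i ∈ S, some i = x := by
  simp

theorem none_notMem_map_some (S : Finset V) : none ∉ S.map Function.Embedding.some := by simp

theorem wIndep_map_some {R : Type*} [CommRing R] (w : Option V → R) (S : Finset V) :
    wIndep (extendedGraph G K) w (S.map Function.Embedding.some) =
      wIndep G (fun j => w (some j)) S := by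
  unfold wIndep
  symm
  refine Finset.sum_bij (fun T _ => T.map Function.Embedding.some) ?_ ?_ ?_ ?_
  · intro T hT
    simp only [Finset.mem_filter, Finset.mem_powerset] at hT ⊢
    refine ⟨Finset.map_subset_map.2 hT.1, ?_⟩
    intro x hx y hy hxy
    obtain ⟨i, hi, rfl⟩ := mem_map_some.1 hx
    obtain ⟨j, hj, rfl⟩ := mem_map_some.1 hy
    exact hT.2 hi hj (fun h => hxy (h ▸ rfl))
  · intro T _ T' _ h
    exact Finset.map_injective _ h
  · intro T hT
    simp only [Finset.mem_filter, Finset.mem_powerset] at hT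
    obtain ⟨T', hT', rfl⟩ := Finset.subset_map_iff.1 hT.1
    refine ⟨T', Finset.mem_filter.2 ⟨Finset.mem_powerset.2 hT', ?_⟩, rfl⟩
    intro i hi j hj hij
    exact hT.2 (Finset.mem_coe.2 (mem_map_some.2 ⟨i, hi, rfl⟩))
      (Finset.mem_coe.2 (mem_map_some.2 ⟨j, hj, rfl⟩)) (fun h => hij (Option.some.inj h))
  · intro T _
    rw [Finset.prod_map]; rfl

theorem map_wIndep {R R' : Type*} [CommRing R] [CommRing R'] (f : R →+* R') (w : V → R)
    (S : Finset V) : f (wIndep G w S) = wIndep G (fun j => f (w j)) S := by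
  simp only [wIndep, map_sum, map_prod]

theorem indepPoly_eq_wIndep (b : V → ℝ) (S : Finset V) :
    indepPoly G b S = wIndep G (fun j => -(X * C (b j ^ 2))) S := by
  unfold indepPoly wIndep
  refine Finset.sum_congr rfl fun T _ => ?_
  rw [← Finset.prod_const, ← Finset.prod_mul_distrib]
  exact Finset.prod_congr rfl fun j _ => by ring

theorem aeval_indepPoly (b : V → ℝ) (S : Finset V) (c : Option V → ℝ)
    (hc : ∀ j, c (some j) = b j ^ 2) (z : ℂ) :
    aeval z (indepPoly G b S) =
      wIndep (extendedGraph G K) (fun j => -(z * c j)) (S.map Function.Embedding.some) := by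
  rw [wIndep_map_some, indepPoly_eq_wIndep]
  refine (map_wIndep (aeval z : ℝ[X] →ₐ[ℝ] ℂ).toRingHom _ S).trans ?_
  congr 1
  funext j
  simp [hc]

variable {b : V → ℝ}

/-- The squared couplings, extended by one to the new vertex. -/
def coupling (b : V → ℝ) : Option V → ℝ := fun v => v.elim 1 fun j => b j ^ 2

theorem coupling_pos (hb : ∀ j, b j ≠ 0) (v : Option V) : 0 < coupling b v := by
  rcases v with _ | j
  · exact one_pos
  · exact pow_pos (abs_pos.2 (hb j)) 2 |>.trans_eq (sq_abs _)

variable [Fintype V]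

theorem rest_none : rest (extendedGraph G K) none (Finset.univ.map Function.Embedding.some) =
    (Finset.univ \ K).map Function.Embedding.some := by
  ext x
  rcases x with _ | i
  · simp [mem_rest]
  · simp [mem_rest]

theorem nbrs_none : nbrs (extendedGraph G K) none (Finset.univ.map Function.Embedding.some) =
    K.map Function.Embedding.some := by
  ext x
  rcases x with _ | i
  · simp [mem_nbrs]
  · simp [mem_nbrs]

theorem isClique_nbrs_none (hK : G.IsClique (K : Set V)) :
    (extendedGraph G K).IsClique (nbrs (extendedGraph G K) none
      (Finset.univ.map Function.Embedding.some) : Set (Option V)) := by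
  rw [nbrs_none]
  intro x hx y hy hxy
  obtain ⟨i, hi, rfl⟩ := mem_map_some.1 hx
  obtain ⟨j, hj, rfl⟩ := mem_map_some.1 hy
  exact hK hi hj (fun h => hxy (h ▸ rfl))

theorem far_eq_residual (L : List (Option V)) :
    far (extendedGraph G K) L (Finset.univ.map Function.Embedding.some) =
      (residual G K L).map Function.Embedding.some := by
  ext x
  rcases x with _ | i
  · simp [far]
  · simp [far, residual]

theorem sum_inducedPathsFrom_none {M : Type*} [AddCommMonoid M] (F : List (Option V) → M) :
    ∑ l ∈ inducedPathsFrom (extendedGraph G K) none, F l =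
      ∑ T ∈ tails (extendedGraph G K) (Finset.univ.map Function.Embedding.some) none,
        F (none :: T) := by
  have hset : inducedPathsFrom (extendedGraph G K) none =
      (tails (extendedGraph G K) (Finset.univ.map Function.Embedding.some) none).image
        (List.cons none) := by
    ext l
    rw [mem_inducedPathsFrom, Finset.mem_image]
    constructor
    · rintro ⟨hp, hh⟩
      obtain ⟨T, rfl⟩ := List.head?_eq_some_iff.1 hh
      refine ⟨T, mem_tails.2 ⟨hp, fun x hx => ?_⟩, rfl⟩
      have := (List.nodup_cons.1 hp.2.1).1
      rcases x with _ | i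
      · exact absurd hx this
      · simp
    · rintro ⟨T, hT, rfl⟩
      exact ⟨(mem_tails.1 hT).1, rfl⟩
  rw [hset, Finset.sum_image]
  intro a _ b _ h
  exact (List.cons.inj h).2

/-- By connectedness a nonempty closed set contains all vertices of `G`, in particular one of the
nonempty clique, so the new vertex is a root. -/
theorem isRooted_univ (hconn : G.Connected) (hK : IsSimplicialClique G K) :
    IsRooted (extendedGraph G K) (Finset.univ.map Function.Embedding.some) := by
  intro T hTS ⟨x, hx⟩ hclosed
  have hreach : ∀ i j : V, G.Reachable i j → some i ∈ T → some j ∈ T := by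
    rintro i j ⟨p⟩
    induction p with
    | nil => exact id
    | cons h _ ih => exact fun hi => ih (hclosed _ hi _ (by simp) h)
  obtain ⟨i, -, rfl⟩ := mem_map_some.1 (hTS hx)
  obtain ⟨k, hk⟩ := hK.1
  refine ⟨none, none_notMem_map_some _, isClique_nbrs_none hK.2.1, some k,
    hreach i k (hconn.preconnected i k) hx, ?_⟩
  rw [nbrs_none]
  exact mem_map_some.2 ⟨k, hk, rfl⟩

/-! ### Roots of the independence polynomial -/

theorem aeval_fullPoly_ne_zero (hconn : G.Connected) (hK : IsSimplicialClique G K)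
    (hb : ∀ j, b j ≠ 0) {z : ℂ} (hz : 0 < z.im) : aeval z (fullPoly G b) ≠ 0 := by
  rw [fullPoly, aeval_indepPoly (K := K) b _ (coupling b) fun _ => rfl]
  exact ((isRooted_univ hconn hK).halfPlane hK.2.2 (coupling_pos hb) hz).1

theorem aeval_div_im_nonneg (hconn : G.Connected) (hK : IsSimplicialClique G K)
    (hb : ∀ j, b j ≠ 0) {z : ℂ} (hz : 0 < z.im) :
    0 ≤ (aeval z (deletedPoly G K b) / aeval z (fullPoly G b)).im := by
  rw [fullPoly, deletedPoly, aeval_indepPoly (K := K) b _ (coupling b) fun _ => rfl,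
    aeval_indepPoly (K := K) b _ (coupling b) fun _ => rfl, ← rest_none]
  exact (((isRooted_univ hconn hK).halfPlane hK.2.2 (coupling_pos hb) hz).2 none
    (none_notMem_map_some _) (isClique_nbrs_none hK.2.1)).1

theorem eval_fullPoly_pos {x : ℝ} (hx : x ≤ 0) : 0 < (fullPoly G b).eval x := by
  simp only [fullPoly, indepPoly, eval_finsetSum, eval_mul, eval_pow, eval_neg, eval_X,
    eval_prod, eval_C]
  have hnn : ∀ T : Finset V, 0 ≤ (-x) ^ T.card * ∏ j ∈ T, b j ^ 2 := fun T =>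
    mul_nonneg (pow_nonneg (by linarith) _) (Finset.prod_nonneg fun j _ => sq_nonneg _)
  refine Finset.sum_pos' (fun T _ => hnn T) ⟨∅, ?_, by simp⟩
  simp [SimpleGraph.IsIndepSet]

/-- There is no zero in the upper half-plane, and by conjugation none in the lower one. -/
theorem splits_fullPoly (hconn : G.Connected) (hK : IsSimplicialClique G K)
    (hb : ∀ j, b j ≠ 0) : (fullPoly G b).Splits := by
  refine Splits.of_splits_map (algebraMap ℝ ℂ) (IsAlgClosed.splits _) fun z hz => ?_
  have hroot : aeval z (fullPoly G b) = 0 := by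
    rw [← eval_map_algebraMap]
    exact (mem_roots'.1 hz).2
  have him : z.im = 0 := by
    rcases lt_trichotomy z.im 0 with h | h | h
    · refine absurd ?_ (aeval_fullPoly_ne_zero hconn hK hb
        (z := (starRingEnd ℂ) z) (by simpa using h))
      rw [aeval_conj, hroot, map_zero]
    · exact h
    · exact absurd hroot (aeval_fullPoly_ne_zero hconn hK hb h)
  exact ⟨z.re, Complex.ext rfl (by simp [him])⟩

/-- All maximum independent sets contribute to the top coefficient with the same sign, so nothing
cancels. -/
theorem natDegree_fullPoly (hb : ∀ j, b j ≠ 0) : (fullPoly G b).natDegree = G.indepNum := by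
  have hterm : ∀ T : Finset V, (-X : ℝ[X]) ^ T.card * ∏ j ∈ T, C (b j ^ 2) =
      C ((-1) ^ T.card * ∏ j ∈ T, b j ^ 2) * X ^ T.card := by
    intro T
    rw [neg_pow, C_mul, C_pow, C_neg, C_1, map_prod]
    ring
  have hpoly : fullPoly G b = ∑ T ∈ (Finset.univ : Finset V).powerset.filter
      (fun T : Finset V => G.IsIndepSet (T : Set V)),
      C ((-1) ^ T.card * ∏ j ∈ T, b j ^ 2) * X ^ T.card :=
    Finset.sum_congr rfl fun T _ => hterm T
  apply natDegree_eq_of_le_of_coeff_ne_zero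
  · rw [hpoly]
    refine natDegree_sum_le_of_forall_le _ _ fun T hT => ?_
    exact (natDegree_C_mul_X_pow_le _ _).trans (Finset.mem_filter.1 hT).2.card_le_indepNum
  · rw [hpoly, finsetSum_coeff]
    have hsum : ∑ T ∈ (Finset.univ : Finset V).powerset.filter
        (fun T : Finset V => G.IsIndepSet (T : Set V)),
        (C ((-1) ^ T.card * ∏ j ∈ T, b j ^ 2) * X ^ T.card : ℝ[X]).coeff G.indepNum =
        (-1) ^ G.indepNum * ∑ T ∈ (Finset.univ : Finset V).powerset.filter
          (fun T : Finset V => G.IsIndepSet (T : Set V)),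
          if G.indepNum = T.card then ∏ j ∈ T, b j ^ 2 else 0 := by
      rw [Finset.mul_sum]
      refine Finset.sum_congr rfl fun T _ => ?_
      rw [coeff_C_mul_X_pow]
      split_ifs with h
      · rw [h]
      · simp
    rw [hsum]
    refine mul_ne_zero (pow_ne_zero _ (by norm_num)) (ne_of_gt ?_)
    have hprod : ∀ T : Finset V, 0 < ∏ j ∈ T, b j ^ 2 := fun T =>
      Finset.prod_pos fun j _ => coupling_pos hb (some j)
    obtain ⟨T, hT⟩ := G.exists_isNIndepSet_indepNum
    refine Finset.sum_pos' (fun T _ => ?_) ⟨T, ?_, ?_⟩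
    · split_ifs
      · exact (hprod T).le
      · exact le_rfl
    · simpa using hT.isIndepSet
    · rw [if_pos hT.card_eq.symm]; exact hprod T

theorem card_positive_roots_fullPoly (hconn : G.Connected) (hK : IsSimplicialClique G K)
    (hb : ∀ j, b j ≠ 0) :
    Multiset.card ((fullPoly G b).roots.filter fun x => 0 < x) = G.indepNum := by
  have hfilter : (fullPoly G b).roots.filter (fun x => 0 < x) = (fullPoly G b).roots := by
    rw [Multiset.filter_eq_self]
    intro x hx
    by_contra! h
    exact (eval_fullPoly_pos h).ne' (mem_roots'.1 hx).2
  rw [hfilter, ← (splits_fullPoly hconn hK hb).natDegree_eq_card_roots, natDegree_fullPoly hb]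

theorem radicand_pos (hconn : G.Connected) (hK : IsSimplicialClique G K) (hb : ∀ j, b j ≠ 0)
    {u : ℝ} (hu : IsGenericRoot G K b u) : 0 < radicand G K b u := by
  obtain ⟨hu0, hp, hp', hd⟩ := hu
  have h := eval_mul_derivative_neg (fun z hz => aeval_div_im_nonneg hconn hK hb hz) hp hp' hd
  have hsq : 0 < u ^ 2 := pow_pos (abs_pos.2 hu0) 2 |>.trans_eq (sq_abs _)
  rw [radicand]
  nlinarith [mul_pos hsq (neg_pos.2 h)]

end Transport

/-! ### Clifford families from representations, with constant and polynomial coefficients -/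

section Representation

attribute [local instance] Polynomial.algebra

variable {W : Type*} {Γ : SimpleGraph W} {A : Type*} [Ring A] [Algebra ℂ A]

theorem gen_isCliffordFamily (Γ : SimpleGraph W) :
    IsCliffordFamily Γ (fun _ => (1 : ℂ)) (gen Γ) where
  sq v := by
    rw [gen, ← map_mul, RingQuot.mkAlgHom_rel ℂ (CliffordRel.sq v), map_one, map_one]
  anti v w h := by
    rw [gen, gen, ← map_mul, RingQuot.mkAlgHom_rel ℂ (CliffordRel.anti v w h), map_neg, map_mul]
  comm v w h := by
    rw [gen, gen, ← map_mul, RingQuot.mkAlgHom_rel ℂ (CliffordRel.comm v w h), map_mul]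

theorem IsCliffordFamily.map {B : Type*} [Ring B] [Algebra ℂ B] {β : W → ℂ} {op : W → B}
    (h : IsCliffordFamily Γ β op) (φ : B →ₐ[ℂ] A) : IsCliffordFamily Γ β fun w => φ (op w) where
  sq v := by rw [← map_mul, h.sq, φ.commutes]
  anti v w hvw := by rw [← map_mul, h.anti v w hvw, map_neg, map_mul]
  comm v w hvw := by rw [← map_mul, h.comm v w hvw, map_mul]

theorem IsCliffordFamily.smul {β : W → ℂ} {op : W → A} (h : IsCliffordFamily Γ β op) (c : W → ℂ) :
    IsCliffordFamily Γ (fun w => c w ^ 2 * β w) fun w => c w • op w where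
  sq v := by
    rw [smul_mul_smul_comm, h.sq, map_mul, Algebra.smul_def, pow_two (c v)]
  anti v w hvw := by
    rw [smul_mul_smul_comm, smul_mul_smul_comm, h.anti v w hvw, smul_neg, mul_comm (c v)]
  comm v w hvw := by
    rw [smul_mul_smul_comm, smul_mul_smul_comm, h.comm v w hvw, mul_comm (c v)]

/-- Over `ℂ[X]` the path-sum identities can be applied with `u = X`, which makes them identities
between generating polynomials. -/
theorem IsCliffordFamily.polynomial {β : W → ℂ} {op : W → A} (h : IsCliffordFamily Γ β op) :
    IsCliffordFamily Γ (fun w => (C (β w) : ℂ[X])) fun w => (C (op w) : A[X]) where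
  sq v := by
    rw [← C_mul, h.sq, Polynomial.algebraMap_def, coe_mapRingHom, map_C]
  anti v w hvw := by rw [← C_mul, h.anti v w hvw, C_neg, C_mul]
  comm v w hvw := by rw [← C_mul, h.comm v w hvw, C_mul]

theorem evalAt_pathSum [Fintype W] (β : W → ℂ) (op : W → A) (S : Finset W) (v : W) (u : ℂ) :
    evalAt A u (pathSum Γ (fun w => (C (β w) : ℂ[X])) (fun w => (C (op w) : A[X])) X S v) =
      pathSum Γ β op u S v := by
  rw [pathSum, pathSum, map_sum]
  refine Finset.sum_congr rfl fun T _ => ?_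
  have hprod : (T.map fun w => (C (op w) : A[X])).prod = C (T.map op).prod := by
    rw [map_list_prod, List.map_map]; rfl
  rw [hprod, ← C_mul, evalAt_smul, evalAt_C]
  congr 1
  rw [pathCoeff, pathCoeff, eval_mul, eval_pow, eval_neg, eval_X]
  congr 1
  refine (map_wIndep (evalRingHom u) _ _).trans ?_
  congr 1
  funext j
  simp only [wt, map_neg, map_mul, map_pow, coe_evalRingHom, eval_X, eval_C]

end Representation

/-! ### The modes: energies and canonical anticommutation relations -/

section Main

attribute [local instance] Polynomial.algebra

variable {V : Type*} {G : SimpleGraph V} {K : Finset V} {b : V → ℝ}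
  {A : Type*} [Ring A] [Algebra ℂ A] {φ : GraphClifford (extendedGraph G K) →ₐ[ℂ] A}

theorem vertexOp_isCliffordFamily :
    IsCliffordFamily (extendedGraph G K) (fun w => (coupling b w : ℂ)) (vertexOp G K b φ) := by
  have h := ((gen_isCliffordFamily (extendedGraph G K)).map φ).smul
    (fun w : Option V => w.elim 1 fun j => (b j : ℂ))
  convert h using 1
  · funext w
    rcases w with _ | j <;> simp [coupling]
  · funext w
    rcases w with _ | j <;> simp [vertexOp]

/-- The independence polynomial in the variable `u²`, with complex coefficients. -/
theorem wIndep_wt_eq_comp (S : Finset V) :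
    wIndep (extendedGraph G K) (wt (fun w => (C (coupling b w : ℂ) : ℂ[X])) X)
      (S.map Function.Embedding.some) =
      ((indepPoly G b S).map Complex.ofRealHom).comp (X ^ 2) := by
  rw [wIndep_map_some, indepPoly_eq_wIndep]
  symm
  refine (map_wIndep ((compRingHom (X ^ 2)).comp (mapRingHom Complex.ofRealHom)) _ S).trans ?_
  congr 1
  funext j
  simp [wt, coupling]

variable [Fintype V]

theorem eval_map_comp_sq (p : ℝ[X]) (u : ℝ) :
    ((p.map Complex.ofRealHom).comp (X ^ 2)).eval (u : ℂ) = ((p.eval (u ^ 2) : ℝ) : ℂ) := by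
  rw [eval_comp, eval_pow, eval_X, ← Complex.ofReal_pow]
  exact eval_map_apply (f := Complex.ofRealHom) _

theorem eval_derivative_map_comp_sq (p : ℝ[X]) (u : ℝ) :
    (derivative ((p.map Complex.ofRealHom).comp (X ^ 2))).eval (u : ℂ) =
      2 * u * (((derivative p).eval (u ^ 2) : ℝ) : ℂ) := by
  rw [derivative_comp, derivative_map, eval_mul, eval_map_comp_sq]
  simp [one_add_one_eq_two]

theorem mode_eq (u : ℝ) :
    mode G K b φ u = (1 / normFactor G K b u : ℂ) •
      pathSum (extendedGraph G K) (fun w => (coupling b w : ℂ)) (vertexOp G K b φ) (u : ℂ)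
        (Finset.univ.map Function.Embedding.some) none := by
  rw [mode, sum_inducedPathsFrom_none, pathSum]
  congr 1
  refine Finset.sum_congr rfl fun T _ => ?_
  rw [pathProduct, List.map_cons, List.prod_cons]
  congr 1
  rw [pathCoeff, far_eq_residual, List.length_cons, Nat.add_sub_cancel, Complex.ofReal_mul]
  congr 1
  · push_cast; rfl
  · rw [← eval_map_comp_sq, ← wIndep_wt_eq_comp (K := K)]
    refine (map_wIndep (evalRingHom (u : ℂ)) _ _).trans ?_
    congr 1
    funext j
    simp only [wt, map_neg, map_mul, map_pow, coe_evalRingHom, eval_X, eval_C]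

theorem sum_vertexOp :
    ∑ i ∈ Finset.univ.map Function.Embedding.some, vertexOp G K b φ i = hamiltonian G K b φ := by
  rw [Finset.sum_map]; rfl

/-- The generating polynomial of the path sums, with coefficients in the representation. -/
def pathPoly (G : SimpleGraph V) (K : Finset V) (b : V → ℝ)
    (φ : GraphClifford (extendedGraph G K) →ₐ[ℂ] A) : A[X] :=
  pathSum (extendedGraph G K) (fun w => (C (coupling b w : ℂ) : ℂ[X]))
    (fun w => (C (vertexOp G K b φ w) : A[X])) X (Finset.univ.map Function.Embedding.some) none

theorem commutator_pathPoly (hG : IsECF G) (hK : IsSimplicialClique G K) :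
    (X : ℂ[X]) • (C (hamiltonian G K b φ) * pathPoly G K b φ -
      pathPoly G K b φ * C (hamiltonian G K b φ)) =
      (2 : ℂ[X]) • (pathPoly G K b φ -
        ((fullPoly G b).map Complex.ofRealHom).comp (X ^ 2) • C (vertexOp G K b φ none)) := by
  have h := (vertexOp_isCliffordFamily (b := b) (φ := φ)).polynomial.commutator_pathSum X hK.2.2
    (hG.1.extendedGraph hK.2.1) (Finset.univ.map Function.Embedding.some) none
    (none_notMem_map_some _) (isClique_nbrs_none hK.2.1)
  rw [← map_sum C, sum_vertexOp, wIndep_wt_eq_comp] at h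
  exact h

theorem anticomm_pathPoly :
    C (vertexOp G K b φ none) * pathPoly G K b φ + pathPoly G K b φ * C (vertexOp G K b φ none) =
      algebraMap ℂ[X] A[X] (2 * ((deletedPoly G K b).map Complex.ofRealHom).comp (X ^ 2)) := by
  have h := (vertexOp_isCliffordFamily (b := b) (φ := φ)).polynomial.anticomm_pathSum_self X
    (none_notMem_map_some Finset.univ)
  rw [rest_none, wIndep_wt_eq_comp] at h
  have hone : (C (coupling b none : ℂ) : ℂ[X]) = 1 := by simp [coupling]
  rw [hone, one_mul] at h
  exact h

theorem mode_eq_evalAt (u : ℝ) :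
    mode G K b φ u = (1 / normFactor G K b u : ℂ) • evalAt A (u : ℂ) (pathPoly G K b φ) := by
  rw [mode_eq, pathPoly, evalAt_pathSum]

theorem commutator_mode (hG : IsECF G) (hK : IsSimplicialClique G K) {u : ℝ}
    (hu : IsGenericRoot G K b u) :
    hamiltonian G K b φ * mode G K b φ u - mode G K b φ u * hamiltonian G K b φ =
      (2 * (1 / (u : ℂ))) • mode G K b φ u := by
  have hu0 : (u : ℂ) ≠ 0 := Complex.ofReal_ne_zero.2 hu.1
  have h := congrArg (evalAt A (u : ℂ)) (commutator_pathPoly (b := b) (φ := φ) hG hK)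
  simp only [evalAt_smul, map_sub, map_mul, evalAt_C, eval_X, eval_ofNat, eval_map_comp_sq, hu.2.1,
    Complex.ofReal_zero, zero_smul, sub_zero] at h
  rw [mode_eq_evalAt, mul_smul_comm, smul_mul_assoc, ← smul_sub, smul_comm (2 * (1 / (u : ℂ)))]
  congr 1
  rw [← inv_smul_smul₀ hu0 (_ - _), h, smul_smul]
  congr 1
  field_simp

theorem anticomm_mode (hconn : G.Connected) (hG : IsECF G) (hK : IsSimplicialClique G K)
    (hb : ∀ j, b j ≠ 0) {u v : ℝ} (hu : IsGenericRoot G K b u) (hv : IsGenericRoot G K b v) :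
    mode G K b φ u * mode G K b φ v + mode G K b φ v * mode G K b φ u =
      if u + v = 0 then 1 else 0 := by
  have hcomm := commutator_pathPoly (b := b) (φ := φ) hG hK
  have hχ := anticomm_pathPoly (G := G) (K := K) (b := b) (φ := φ)
  rw [mode_eq_evalAt, mode_eq_evalAt, smul_mul_smul_comm, smul_mul_smul_comm,
    mul_comm (1 / (normFactor G K b v : ℂ)), ← smul_add]
  split_ifs with huv
  · obtain rfl : v = -u := by linarith
    have hroot : (((fullPoly G b).map Complex.ofRealHom).comp (X ^ 2)).eval (u : ℂ) = 0 := by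
      rw [eval_map_comp_sq, hu.2.1, Complex.ofReal_zero]
    have hpos := radicand_pos hconn hK hb hu
    have hnorm : normFactor G K b (-u) = normFactor G K b u := by
      simp only [normFactor, radicand, neg_sq]
    have hsq : normFactor G K b u * normFactor G K b u = 4 * radicand G K b u := by
      rw [normFactor, mul_mul_mul_comm, Real.mul_self_sqrt hpos.le]; norm_num
    have hsq' : 1 / (normFactor G K b u : ℂ) * (1 / (normFactor G K b u : ℂ)) =
        ((4 * radicand G K b u : ℝ) : ℂ)⁻¹ := by
      rw [← hsq]; push_cast; rw [mul_inv, one_div]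
    rw [hnorm, hsq', Complex.ofReal_neg, evalAt_anticomm_neg hcomm hχ hroot, ← Complex.ofReal_neg,
      eval_derivative_map_comp_sq, eval_map_comp_sq, neg_sq, Algebra.algebraMap_eq_smul_one,
      smul_smul]
    have hne : ((4 * radicand G K b u : ℝ) : ℂ) ≠ 0 :=
      Complex.ofReal_ne_zero.2 (by positivity)
    -- The derivative of `P_G(u²)` at `-u` is `-2u P_G'(u²)`, so the anticommutator before
    -- normalization is `-4u² P_{G∖K} P_G'`, the square of the normalization factor.
    have hval : 2 * ((u : ℂ) * (2 * ((-u : ℝ) : ℂ) *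
        (((derivative (fullPoly G b)).eval (u ^ 2) : ℝ) : ℂ)) *
        (((deletedPoly G K b).eval (u ^ 2) : ℝ) : ℂ)) = ((4 * radicand G K b u : ℝ) : ℂ) := by
      rw [radicand]; push_cast; ring
    rw [hval, inv_mul_cancel₀ hne, one_smul]
  -- Both terms on the right carry a factor `P_G(u²)` or `P_G(v²)` and vanish. This includes `u =
  -- v`, where the mode squares to zero.
  · have h := add_smul_evalAt_anticomm hcomm hχ (u : ℂ) (v : ℂ)
    simp only [eval_map_comp_sq, hu.2.1, hv.2.1, Complex.ofReal_zero, mul_zero, zero_mul,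
      add_zero, map_zero] at h
    have hne : (u : ℂ) + v ≠ 0 := by exact_mod_cast huv
    rw [(smul_eq_zero.1 h).resolve_left hne, smul_zero]

end Main

end HiddenFreeFermion

end

theorem theorem1 {V : Type*} [Fintype V] (G : SimpleGraph V) (hconn : G.Connected)
    (hG : HiddenFreeFermion.IsECF G)
    (K : Finset V) (hK : HiddenFreeFermion.IsSimplicialClique G K)
    (b : V → ℝ) (hb : ∀ j, b j ≠ 0)
    {A : Type*} [Ring A] [Algebra ℂ A]
    (φ : HiddenFreeFermion.GraphClifford (HiddenFreeFermion.extendedGraph G K) →ₐ[ℂ] A) :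
    -- with multiplicity there are `α_G` positive roots `x = u_k²`
    Multiset.card ((HiddenFreeFermion.fullPoly G b).roots.filter (fun x => 0 < x)) = G.indepNum ∧
    -- the normalization is real and positive, and the mode has energy `1 / u`
    (∀ u : ℝ, HiddenFreeFermion.IsGenericRoot G K b u →
      0 < HiddenFreeFermion.radicand G K b u ∧
      HiddenFreeFermion.hamiltonian G K b φ * HiddenFreeFermion.mode G K b φ u
          - HiddenFreeFermion.mode G K b φ u * HiddenFreeFermion.hamiltonian G K b φ
        = (2 * (1 / (u : ℂ))) • HiddenFreeFermion.mode G K b φ u) ∧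
    -- the canonical anticommutation relations
    (∀ u v : ℝ, HiddenFreeFermion.IsGenericRoot G K b u → HiddenFreeFermion.IsGenericRoot G K b v →
      HiddenFreeFermion.mode G K b φ u * HiddenFreeFermion.mode G K b φ v
          + HiddenFreeFermion.mode G K b φ v * HiddenFreeFermion.mode G K b φ u
        = if u + v = 0 then 1 else 0) := by
  exact ⟨HiddenFreeFermion.card_positive_roots_fullPoly hconn hK hb,
    fun _ hu => ⟨HiddenFreeFermion.radicand_pos hconn hK hb hu,
      HiddenFreeFermion.commutator_mode hG hK hu⟩,
    fun _ _ hu hv => HiddenFreeFermion.anticomm_mode hconn hG hK hb hu hv⟩
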